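/- Let $\pi:E\to M$ be a smooth fibred manifold (a smooth surjective submersion of finite-dimensional smooth manifolds), let $n=\dim M$, let $r\ge 0$ and $0<k\le n$. A section means a smooth local section of $\pi$, defined on an open subset of $M$; for a section $s$, $j_rs$ is its $r$-jet prolongation, a local section of the jet space $J^r\pi\to M$. Let $\Lambda^k_r$ be the set of smooth $k$-forms on $J^r\pi$. A $k$-form on $J^{r+1}\pi$ is called horizontal if it vanishes whenever one of its arguments is vertical over $M$. Let $\mathcal H_P\Lambda^k_{r+1}$ be the set of smooth horizontal $k$-forms on $J^{r+1}\pi$ that are polynomial of degree at most $k$ along the fibres of the affine bundle $J^{r+1}\pi\to J^r\pi$, i.e. whose coefficients, in the coordinates $(x^\lambda,u^i_\sigma)_{|\sigma|\le r+1}$ induced by any adapted chart, are polynomials of degree at most $k$ in the variables $u^i_\sigma$ with $|\sigma|=r+1$ when all the other coordinates are fixed. For $\theta\in J^{r+1}\pi$ over $x\in M$, with image $\theta_r\in J^r\pi$, let $D_\theta:T_xM\to T_{\theta_r}J^r\pi$ be the contact map, $D_\theta=T_x(j_rs)$ for any section $s$ with $j_{r+1}s(x)=\theta$. For $\beta\in\Lambda^k_r$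 let the horizontalization $h(\beta)$ be the $k$-form on $J^{r+1}\pi$ given by $$h(\beta)_\theta(v_1,\dots,v_k)=\beta_{\theta_r}\bigl(D_\theta(T\pi^{r+1}v_1),\dots,D_\theta(T\pi^{r+1}v_k)\bigr),\qquad v_1,\dots,v_k\in T_\theta J^{r+1}\pi,$$ where $\pi^{r+1}:J^{r+1}\pi\to M$ is the projection. Put $\overline\Lambda{}^k_r=h(\Lambda^k_r)$. Then: 1. $\overline\Lambda{}^k_r\subseteq\mathcal H_P\Lambda^k_{r+1}$. 2. $\overline\Lambda{}^k_r$ is a module over $C^\infty(J^r\pi)$: it contains $0$ and is closed under addition and under multiplication by the pull-backs to $J^{r+1}\pi$ of smooth functions on $J^r\pi$. 3. A form $\alpha\in\mathcal H_P\Lambda^k_{r+1}$ belongs to $\overline\Lambda{}^k_r$ if and only if there is $\beta\in\Lambda^k_r$ such that $(j_rs)^*\beta=(j_{r+1}s)^*\alpha$ on the domain of $s$ for every section $s$ of $\pi$. -/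

import Mathlib

open scoped Manifold ContDiff Topology

noncomputable section

namespace FibredJet

open Set

/-! ### Preliminaries on iterated derivatives -/

section Calculus

variable {P V W W' : Type*} [NormedAddCommGroup P] [NormedSpace ℝ P]
  [NormedAddCommGroup V] [NormedSpace ℝ V]
  [NormedAddCommGroup W] [NormedSpace ℝ W] [NormedAddCommGroup W'] [NormedSpace ℝ W']

/-- Iterated derivatives are symmetric. -/
theorem iteratedFDeriv_perm {f : V → W} (n : ℕ) :
    ∀ {x : V}, ContDiffAt ℝ n f x → ∀ σ : Equiv.Perm (Fin n),
      (iteratedFDeriv ℝ n f x).domDomCongr σ = iteratedFDeriv ℝ n f x := by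
  induction n with
  | zero => intro x _ σ; ext v; simp [Subsingleton.elim σ 1]
  | succ n ih =>
    intro x hx σ
    have hmem : σ ∈ Submonoid.closure (Set.range fun i : Fin n => Equiv.swap i.castSucc i.succ) := by
      rw [Equiv.Perm.mclosure_swap_castSucc_succ]; trivial
    induction hmem using Submonoid.closure_induction with
    | one => ext v; rfl
    | mul a b _ _ ha hb =>
      ext v
      have h1 := DFunLike.congr_fun ha v
      have h2 := DFunLike.congr_fun hb (fun i => v (a i))
      simp only [ContinuousMultilinearMap.domDomCongr_apply] at h1 h2 ⊢
      rw [← h1, ← h2]; rfl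
    | mem τ hτ =>
      obtain ⟨i, rfl⟩ := hτ
      have hdiff : ∀ᶠ y in 𝓝 x, DifferentiableAt ℝ (iteratedFDeriv ℝ n f) y := by
        filter_upwards [hx.eventually (by simp)] with y hy
        exact (hy.iteratedFDeriv_right (m := 1) (i := n)
          (by rw [add_comm]; norm_cast)).differentiableAt (by simp)
      ext v
      rw [ContinuousMultilinearMap.domDomCongr_apply]
      cases n with
      | zero => exact i.elim0
      | succ m =>
        induction i using Fin.cases with
        | zero =>
          have hd' : ∀ᶠ y in 𝓝 x, DifferentiableAt ℝ (iteratedFDeriv ℝ m f) y := by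
            filter_upwards [hx.eventually (by simp)] with y hy
            exact (hy.iteratedFDeriv_right (m := 1) (i := m)
              (by norm_cast; omega)).differentiableAt (by simp)
          have h2 : ContDiffAt ℝ 2 (iteratedFDeriv ℝ m f) x :=
            hx.iteratedFDeriv_right (by norm_cast; omega)
          have hsym := h2.isSymmSndFDerivAt (by simp)
          have hd2 : DifferentiableAt ℝ (fderiv ℝ (iteratedFDeriv ℝ m f)) x :=
            (h2.fderiv_right (m := 1) (by norm_num)).differentiableAt (by simp)
          have key : ∀ w : Fin (m + 2) → V, iteratedFDeriv ℝ (m + 2) f x w =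
              fderiv ℝ (fderiv ℝ (iteratedFDeriv ℝ m f)) x (w 0) (w 1)
                (Fin.tail (Fin.tail w)) := by
            intro w
            rw [hdiff.self_of_nhds.iteratedFDeriv_succ_apply_left']
            have : (fun y => iteratedFDeriv ℝ (m + 1) f y (Fin.tail w)) = fun y =>
                (fderiv ℝ (iteratedFDeriv ℝ m f) y (w 1)) (Fin.tail (Fin.tail w)) := rfl
            rw [this, fderiv_continuousMultilinear_apply_const
              (hd2.clm_apply (differentiableAt_const _)), fderiv_clm_apply hd2
              (differentiableAt_const _)]
            simp
          rw [key, key]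
          have e1 : (Fin.tail (Fin.tail fun i =>
              v (Equiv.swap (Fin.castSucc (0 : Fin (m + 1))) (Fin.succ 0) i))) =
              Fin.tail (Fin.tail v) := by
            funext l
            simp only [Fin.tail]
            rw [Equiv.swap_apply_of_ne_of_ne]
            · simp [Fin.ext_iff]
            · simp [Fin.ext_iff]
          rw [e1]
          simp only [Fin.castSucc_zero, Fin.succ_zero_eq_one, Equiv.swap_apply_left,
            Equiv.swap_apply_right]
          rw [hsym.eq]
        | succ i' =>
          rw [hdiff.self_of_nhds.iteratedFDeriv_succ_apply_left',
            hdiff.self_of_nhds.iteratedFDeriv_succ_apply_left']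
          have hev : (fun y => iteratedFDeriv ℝ (m + 1) f y (Fin.tail fun i =>
              v (Equiv.swap i'.succ.castSucc i'.succ.succ i))) =ᶠ[𝓝 x]
              fun y => iteratedFDeriv ℝ (m + 1) f y (Fin.tail v) := by
            filter_upwards [hx.eventually (by simp)] with y hy
            have := DFunLike.congr_fun (ih (hy.of_le (by norm_cast; omega))
              (Equiv.swap i'.castSucc i'.succ)) (Fin.tail v)
            rw [← this, ContinuousMultilinearMap.domDomCongr_apply]
            congr 1
            funext l
            simp only [Fin.tail]
            rw [← Fin.succ_castSucc]
            congr 1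
            exact ((Fin.succ_injective _).swap_apply _ _ _)
          rw [hev.fderiv_eq]
          congr 2

/-- Partial iterated derivatives of a smooth map of two variables are smooth. -/
theorem contDiffAt_iteratedFDeriv_param {K : P → V → W} {z₀ : P} (j : ℕ) :
    ∀ {y₀ : V}, ContDiffAt ℝ ∞ (Function.uncurry K) (z₀, y₀) →
      ContDiffAt ℝ ∞ (fun q : P × V => iteratedFDeriv ℝ j (K q.1) q.2) (z₀, y₀) := by
  induction j with
  | zero =>
    intro y₀ h
    exact ((continuousMultilinearCurryFin0 ℝ V W).symm.contDiff.contDiffAt).comp (z₀, y₀) h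
  | succ j ih =>
    intro y₀ h
    have h1 : ContDiffAt ℝ ∞ (fun q : P × V => fderiv ℝ (iteratedFDeriv ℝ j (K q.1)) q.2)
        (z₀, y₀) := by
      refine ContDiffAt.fderiv (f := fun q : P × V => iteratedFDeriv ℝ j (K q.1))
        (g := fun q : P × V => q.2) (n := ∞) ?_ contDiffAt_snd (by simp)
      exact (ih h).comp (f := fun p : (P × V) × V => (p.1.1, p.2)) ((z₀, y₀), y₀)
        (by fun_prop)
    exact ((continuousMultilinearCurryLeftEquiv ℝ (fun _ : Fin (j + 1) => V) W).symm.contDiff.contDiffAt).comp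
      (z₀, y₀) h1

/-- The derivatives of order `≤ r` of `f` and `g` at `x` agree. -/
def AgreeTo (r : ℕ) (f g : V → W) (x : V) : Prop :=
  ∀ j ≤ r, iteratedFDeriv ℝ j f x = iteratedFDeriv ℝ j g x

theorem AgreeTo.eq {r : ℕ} {f g : V → W} {x : V} (h : AgreeTo r f g x) : f x = g x := by
  simpa using DFunLike.congr_fun (h 0 (Nat.zero_le _)) 0

theorem AgreeTo.comp {r : ℕ} {f f' : V → W} {x : V} {g : W → W'}
    (hf : ContDiffAt ℝ ∞ f x) (hf' : ContDiffAt ℝ ∞ f' x)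
    (hg : ContDiffAt ℝ ∞ g (f x)) (h : AgreeTo r f f' x) :
    AgreeTo r (g ∘ f) (g ∘ f') x := by
  intro j hj
  rw [iteratedFDeriv_comp (n := ∞) hg hf (by exact_mod_cast le_top),
    iteratedFDeriv_comp (n := ∞) (h.eq ▸ hg) hf' (by exact_mod_cast le_top), ← h.eq]
  simp only [FormalMultilinearSeries.taylorComp]
  refine Finset.sum_congr rfl fun c _ => ?_
  simp only [FormalMultilinearSeries.compAlongOrderedFinpartition, ftaylorSeries]
  congr 1
  funext i
  exact h _ ((c.partSize_le i).trans hj)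

theorem AgreeTo.comp_right {r : ℕ} {g g' : V → W} {x : W'} {f : W' → V}
    (hf : ContDiffAt ℝ ∞ f x) (hg : ContDiffAt ℝ ∞ g (f x)) (hg' : ContDiffAt ℝ ∞ g' (f x))
    (h : AgreeTo r g g' (f x)) : AgreeTo r (g ∘ f) (g' ∘ f) x := by
  intro j hj
  rw [iteratedFDeriv_comp (n := ∞) hg hf (by exact_mod_cast le_top),
    iteratedFDeriv_comp (n := ∞) hg' hf (by exact_mod_cast le_top)]
  simp only [FormalMultilinearSeries.taylorComp]
  refine Finset.sum_congr rfl fun c _ => ?_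
  simp only [FormalMultilinearSeries.compAlongOrderedFinpartition, ftaylorSeries]
  congr 1
  exact h _ (c.length_le.trans hj)

theorem AgreeTo.graph {r : ℕ} {f g : V → W} {x : V} 
    (hf : ContDiffAt ℝ ∞ f x) (hg : ContDiffAt ℝ ∞ g x)
    (h : AgreeTo r f g x) : AgreeTo r (fun y => (y, f y)) (fun y => (y, g y)) x := by
  intro j hj
  rw [iteratedFDeriv_prodMk (n := ∞) (f := fun y => y) contDiffAt_id hf (by exact_mod_cast le_top),
    iteratedFDeriv_prodMk (n := ∞) (f := fun y => y) contDiffAt_id hg (by exact_mod_cast le_top), h j hj]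

end Calculus

/-! ### The model spaces of jets -/

section Model

variable (V W : Type*) [NormedAddCommGroup V] [NormedSpace ℝ V]
  [NormedAddCommGroup W] [NormedSpace ℝ W]

/-- The symmetric continuous `j`-linear maps `V × ⋯ × V → W`, as a subspace of all of them. -/
def symSubmodule (j : ℕ) : Submodule ℝ (V [×j]→L[ℝ] W) where
  carrier := {g | ∀ σ : Equiv.Perm (Fin j), g.domDomCongr σ = g}
  zero_mem' := fun _ => rfl
  add_mem' := fun {a b} ha hb σ => by
    conv_rhs => rw [← ha σ, ← hb σ]
    rfl
  smul_mem' := fun t a ha σ => by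
    conv_rhs => rw [← ha σ]
    rfl

/-- The normed space `⊙ʲ V* ⊗ W` of symmetric continuous `j`-linear maps `V × ⋯ × V → W`. -/
def SymForm (j : ℕ) : Type _ := symSubmodule V W j

instance (j : ℕ) : NormedAddCommGroup (SymForm V W j) :=
  inferInstanceAs (NormedAddCommGroup (symSubmodule V W j))

instance (j : ℕ) : NormedSpace ℝ (SymForm V W j) :=
  inferInstanceAs (NormedSpace ℝ (symSubmodule V W j))

variable {V W}

/-- The inclusion of the symmetric `j`-linear maps into all `j`-linear maps. -/
def SymForm.incl (j : ℕ) : SymForm V W j →L[ℝ] (V [×j]→L[ℝ] W) := (symSubmodule V W j).subtypeL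

theorem SymForm.incl_injective (j : ℕ) : Function.Injective (SymForm.incl (V := V) (W := W) j) :=
  Subtype.val_injective

theorem SymForm.incl_perm {j : ℕ} (g : SymForm V W j) (σ : Equiv.Perm (Fin j)) :
    (SymForm.incl j g).domDomCongr σ = SymForm.incl j g := g.2 σ

/-- The symmetrization `g ↦ (1 / j!) ∑ σ, g ∘ σ`. -/
def symmetrize (j : ℕ) : (V [×j]→L[ℝ] W) →L[ℝ] SymForm V W j :=
  ((j.factorial : ℝ)⁻¹ • ∑ σ : Equiv.Perm (Fin j),
    ((ContinuousMultilinearMap.domDomCongrₗᵢ ℝ V W σ).toContinuousLinearEquiv :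
      (V [×j]→L[ℝ] W) →L[ℝ] (V [×j]→L[ℝ] W))).codRestrict (symSubmodule V W j) (by
  intro g τ
  ext v
  simp only [ContinuousMultilinearMap.domDomCongr_apply, smul_apply, sum_apply]
  congr 1
  exact Fintype.sum_equiv (Equiv.mulLeft τ) _ _ (fun σ => rfl))

theorem incl_symmetrize {j : ℕ} {g : V [×j]→L[ℝ] W}
    (hg : ∀ σ : Equiv.Perm (Fin j), g.domDomCongr σ = g) :
    SymForm.incl j (symmetrize j g) = g := by
  ext v
  have h : ∀ σ : Equiv.Perm (Fin j),
      (ContinuousMultilinearMap.domDomCongrₗᵢ ℝ V W σ) g v = g v := fun σ =>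
    DFunLike.congr_fun (hg σ) v
  change ((j.factorial : ℝ)⁻¹ • ∑ σ : Equiv.Perm (Fin j),
    ((ContinuousMultilinearMap.domDomCongrₗᵢ ℝ V W σ).toContinuousLinearEquiv :
      (V [×j]→L[ℝ] W) →L[ℝ] (V [×j]→L[ℝ] W))) g v = g v
  rw [smul_apply, sum_apply, smul_apply, sum_apply]
  rw [show (∑ σ : Equiv.Perm (Fin j),
      ((ContinuousMultilinearMap.domDomCongrₗᵢ ℝ V W σ).toContinuousLinearEquiv :
        (V [×j]→L[ℝ] W) →L[ℝ] (V [×j]→L[ℝ] W)) g v) = ∑ _σ : Equiv.Perm (Fin j), g v from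
      Finset.sum_congr rfl (fun σ _ => h σ), Finset.sum_const, Finset.card_univ,
    Fintype.card_perm, Fintype.card_fin, ← Nat.cast_smul_eq_nsmul ℝ, smul_smul,
    inv_mul_cancel₀ (by exact_mod_cast Nat.factorial_ne_zero j), one_smul]

theorem symmetrize_incl {j : ℕ} (g : SymForm V W j) : symmetrize j (SymForm.incl j g) = g :=
  SymForm.incl_injective j (incl_symmetrize g.incl_perm)

variable (V W) in
/-- The model space of `r`-jets of maps from `V` to `W`: a base point `x` and the symmetric
derivatives `(u, Du, …, Dʳu)` at `x`; these are the coordinates `(x^λ, u^i_σ)`, `|σ| ≤ r`. -/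
abbrev JetModel (r : ℕ) : Type _ := V × (∀ j : Fin (r + 1), SymForm V W j)

variable {r : ℕ}

/-- The point `(x, u)` under a jet `(x, u, Du, …, Dʳu)`. -/
def JetModel.value (z : JetModel V W r) : V × W := (z.1, SymForm.incl _ (z.2 0) fun _ => 0)

/-- The polynomial map `y ↦ ∑ j ≤ r, (1 / j!) Dʲu (y - x, …, y - x)` with given `r`-jet. -/
def JetModel.taylor (z : JetModel V W r) (y : V) : W :=
  ∑ j : Fin (r + 1), ((j : ℕ).factorial : ℝ)⁻¹ • SymForm.incl j (z.2 j) fun _ => y - z.1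

theorem JetModel.contDiff_taylor :
    ContDiff ℝ ∞ (fun q : JetModel V W r × V => q.1.taylor q.2) := by
  unfold JetModel.taylor
  refine ContDiff.sum fun j _ => ContDiff.const_smul _ ?_
  have h : ContDiff ℝ ∞ (fun q : SymForm V W j × (Fin j → V) => SymForm.incl j q.1 q.2) :=
    contDiff_iff_contDiffAt.2 fun q =>
      (ContinuousLinearMap.cpolynomialAt_uncurry_of_multilinear (SymForm.incl j)).contDiffAt
  exact h.comp (f := fun q : JetModel V W r × V => (q.1.2 j, fun _ : Fin j => q.2 - q.1.1))
    ((((ContinuousLinearMap.proj (R := ℝ) (φ := fun i : Fin (r + 1) => SymForm V W i) j).contDiff).comp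
      (contDiff_snd.comp contDiff_fst)).prodMk
      (contDiff_pi.2 fun _ => contDiff_snd.sub (contDiff_fst.comp contDiff_fst)))

theorem JetModel.contDiff_value : ContDiff ℝ ∞ (JetModel.value : JetModel V W r → V × W) := by
  unfold JetModel.value
  have h : ContDiff ℝ ∞ (fun z : JetModel V W r => SymForm.incl ((0 : Fin (r + 1)) : ℕ) (z.2 0)) :=
    (SymForm.incl _).contDiff.comp ((ContinuousLinearMap.proj (R := ℝ)
      (φ := fun i : Fin (r + 1) => SymForm V W i) 0).contDiff.comp contDiff_snd)
  exact contDiff_fst.prodMk ((ContinuousMultilinearMap.apply ℝ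
    (fun _ : Fin ((0 : Fin (r + 1)) : ℕ) => V) W (fun _ => 0)).contDiff.comp h)

theorem JetModel.iteratedFDeriv_taylor (z : JetModel V W r) (j : Fin (r + 1)) :
    iteratedFDeriv ℝ j z.taylor z.1 = SymForm.incl j (z.2 j) := by
  let p : FormalMultilinearSeries ℝ V W := fun i =>
    if h : i < r + 1 then (i.factorial : ℝ)⁻¹ • SymForm.incl i (z.2 ⟨i, h⟩) else 0
  have hp : HasFiniteFPowerSeriesOnBall z.taylor p z.1 (r + 1) ⊤ := by
    refine HasFiniteFPowerSeriesOnBall.mk' (fun m hm => dif_neg (by omega)) (by simp) ?_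
    intro y _
    rw [← Fin.sum_univ_eq_sum_range (fun i => p i fun _ => y)]
    refine Finset.sum_congr rfl fun i _ => ?_
    simp only [p, i.2, dif_pos, smul_apply, Fin.eta, add_sub_cancel_left]
  have hs := hp.toHasFPowerSeriesOnBall.iteratedFDeriv_eq_sum
    (hp.cpolynomialOn.analyticOnNhd.analyticOn.mono (by simp)) (n := j)
  ext v
  rw [hs]
  have : ∀ σ : Equiv.Perm (Fin (j : ℕ)), (p j fun i => v (σ i)) =
      ((j : ℕ).factorial : ℝ)⁻¹ • SymForm.incl j (z.2 j) v := fun σ => by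
    simp only [p, j.2, dif_pos, smul_apply]
    congr 1
    exact DFunLike.congr_fun ((z.2 j).incl_perm σ) v
  rw [Finset.sum_congr rfl (fun σ _ => this σ), Finset.sum_const, Finset.card_univ,
    Fintype.card_perm, Fintype.card_fin, ← Nat.cast_smul_eq_nsmul ℝ, smul_smul,
    mul_inv_cancel₀ (by exact_mod_cast Nat.factorial_ne_zero j), one_smul]

theorem JetModel.taylor_self (z : JetModel V W r) : z.taylor z.1 = z.value.2 := by
  have h := DFunLike.congr_fun (z.iteratedFDeriv_taylor 0) 0
  exact h

/-- The jet coordinates of a constant map. -/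
def JetModel.ofPoint (w : V × W) : JetModel V W r :=
  (w.1, fun j => symmetrize j (iteratedFDeriv ℝ j (fun _ : V => w.2) w.1))

theorem JetModel.value_ofPoint (w : V × W) : (JetModel.ofPoint (r := r) w).value = w := by
  have h := incl_symmetrize (iteratedFDeriv_perm 0
    (contDiff_const (c := w.2) (n := ((0 : ℕ) : WithTop ℕ∞))).contDiffAt (x := w.1))
  have h2 := DFunLike.congr_fun h (fun _ => (0 : V))
  exact Prod.ext rfl h2

end Model

/-! ### Fibred manifolds and jet spaces -/

section Geometry

variable {V W EE M E : Type*}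
  [NormedAddCommGroup V] [NormedSpace ℝ V] [NormedAddCommGroup W] [NormedSpace ℝ W]
  [NormedAddCommGroup EE] [NormedSpace ℝ EE]
  [TopologicalSpace M] [ChartedSpace V M] [TopologicalSpace E] [ChartedSpace EE E]

variable (V W EE M E) in
/-- A fibred manifold `π : E → M`: a smooth surjective submersion. Here `M` is modelled on `V`,
`E` on `EE`, and `W` is the model of the fibres, so that `EE ≃ V × W`. -/
structure FibredManifold where
  /-- The projection `π`. -/
  proj : E → M
  surjective : Function.Surjective proj
  submersion : Manifold.IsSubmersionOfComplement W 𝓘(ℝ, EE) 𝓘(ℝ, V) ∞ proj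

variable (π : FibredManifold V W EE M E)

namespace FibredManifold

/-- A chart of `E` adapted to the fibring, with values `(x, u)` in `V × W`, together with
the chart of `M` under it. -/
structure AdaptedChart where
  /-- The chart `(x, u)` of `E`. -/
  total : OpenPartialHomeomorph E (V × W)
  /-- The chart `x` of `M`. -/
  base : OpenPartialHomeomorph M V
  smooth_total : ContMDiffOn 𝓘(ℝ, EE) 𝓘(ℝ, V × W) ∞ total total.source
  smooth_total_symm : ContMDiffOn 𝓘(ℝ, V × W) 𝓘(ℝ, EE) ∞ total.symm total.target
  smooth_base : ContMDiffOn 𝓘(ℝ, V) 𝓘(ℝ, V) ∞ base base.source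
  smooth_base_symm : ContMDiffOn 𝓘(ℝ, V) 𝓘(ℝ, V) ∞ base.symm base.target
  mapsTo : ∀ e ∈ total.source, π.proj e ∈ base.source
  adapted : ∀ e ∈ total.source, base (π.proj e) = (total e).1

theorem exists_adaptedChart (e : E) : ∃ c : π.AdaptedChart, e ∈ c.total.source := by
  have h := π.submersion e
  have h1 := contMDiffOn_of_mem_maximalAtlas h.domChart_mem_maximalAtlas
  have h2 := contMDiffOn_symm_of_mem_maximalAtlas h.domChart_mem_maximalAtlas
  refine ⟨⟨h.domChart.transHomeomorph h.equiv.toHomeomorph, h.codChart, ?_, ?_,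
    contMDiffOn_of_mem_maximalAtlas h.codChart_mem_maximalAtlas,
    contMDiffOn_symm_of_mem_maximalAtlas h.codChart_mem_maximalAtlas,
    h.mapsto_domChart_source_codChart_source, ?_⟩, h.mem_domChart_source⟩
  · exact h.equiv.contDiff.contMDiff.comp_contMDiffOn h1
  · exact h2.comp h.equiv.symm.contDiff.contMDiff.contMDiffOn fun _ hx => hx
  · intro e' he'
    have h3 := h.writtenInCharts ((h.domChart.extend 𝓘(ℝ, EE)).map_source (x := e')
      (by simpa using he'))
    simp only [Function.comp, mfld_simps] at h3
    rw [h.domChart.left_inv he'] at h3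
    exact h3

/-- A chosen adapted chart around a point of `E`. -/
def adaptedChartAt (e : E) : π.AdaptedChart := (π.exists_adaptedChart e).choose

theorem mem_adaptedChartAt (e : E) : e ∈ (π.adaptedChartAt e).total.source :=
  (π.exists_adaptedChart e).choose_spec

/-- A smooth local section of `π`, defined on the open set `dom` of `M`. (The values of `toFun`
outside `dom` play no role.) -/
structure LocalSection where
  /-- The underlying map. -/
  toFun : M → E
  /-- The domain. -/
  dom : Set M
  isOpen_dom : IsOpen dom
  smooth : ContMDiffOn 𝓘(ℝ, V) 𝓘(ℝ, EE) ∞ toFun dom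
  isSection : ∀ x ∈ dom, π.proj (toFun x) = x

/-- A local section together with a point of its domain. -/
structure PointedSection where
  /-- The local section. -/
  sec : π.LocalSection
  /-- The point. -/
  pt : M
  mem : pt ∈ sec.dom

variable {π}

/-- The value of a pointed section. -/
def PointedSection.value (p : π.PointedSection) : E := p.sec.toFun p.pt

/-- The coordinate expression `x ↦ u(s(x))` of a map `s : M → E` in an adapted chart. -/
def AdaptedChart.localRep (c : π.AdaptedChart) (s : M → E) (y : V) : W :=
  (c.total (s (c.base.symm y))).2

/-- Two pointed sections have the same `r`-jet if they have the same point and the same value, and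
in every adapted chart around this value all the derivatives of order `≤ r` agree. -/
def SameJet (r : ℕ) (p q : π.PointedSection) : Prop :=
  p.pt = q.pt ∧ p.value = q.value ∧ ∀ c : π.AdaptedChart, p.value ∈ c.total.source →
    AgreeTo r (c.localRep p.sec.toFun) (c.localRep q.sec.toFun) (c.base p.pt)

variable (π) in
/-- Having the same `r`-jet is an equivalence relation. -/
def jetSetoid (r : ℕ) : Setoid π.PointedSection where
  r := SameJet r
  iseqv :=
    { refl := fun _ => ⟨rfl, rfl, fun _ _ _ _ => rfl⟩
      symm := fun ⟨h1, h2, h3⟩ => ⟨h1.symm, h2.symm, fun c hc j hj => by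
        rw [← h1]; exact (h3 c (h2 ▸ hc) j hj).symm⟩
      trans := fun ⟨h1, h2, h3⟩ ⟨h1', h2', h3'⟩ => ⟨h1.trans h1', h2.trans h2', fun c hc j hj =>
        (h3 c hc j hj).trans (by rw [h1]; exact h3' c (h2 ▸ hc) j hj)⟩ }

variable (π) in
/-- The jet space `Jʳπ`. -/
def Jet (r : ℕ) : Type _ := Quotient (π.jetSetoid r)

variable {r : ℕ}

/-- The `r`-jet of a pointed section. -/
def PointedSection.jet (p : π.PointedSection) (r : ℕ) : π.Jet r := Quotient.mk _ p

namespace Jet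

/-- A chosen pointed section representing a jet. -/
def rep (θ : π.Jet r) : π.PointedSection := Quotient.out θ

theorem jet_rep (θ : π.Jet r) : θ.rep.jet r = θ := Quotient.out_eq _

/-- The point of `M` under a jet. -/
def base (θ : π.Jet r) : M := Quotient.lift PointedSection.pt (fun _ _ (h : SameJet r _ _) => h.1) θ

/-- The point of `E` under a jet. -/
def value (θ : π.Jet r) : E := Quotient.lift PointedSection.value (fun _ _ (h : SameJet r _ _) => h.2.1) θ

/-- The projection `π^{r+1}_r : J^{r+1}π → Jʳπ`. -/
def proj (θ : π.Jet (r + 1)) : π.Jet r :=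
  Quotient.map id (fun _ _ (h : SameJet (r + 1) _ _) => ⟨h.1, h.2.1, fun c hc j hj => h.2.2 c hc j (hj.trans r.le_succ)⟩) θ

end Jet

theorem AdaptedChart.mem_target_base (c : π.AdaptedChart) {z : V × W} (hz : z ∈ c.total.target) :
    z.1 ∈ c.base.target := by
  have h := c.total.map_target hz
  have h2 := c.base.map_source (c.mapsTo _ h)
  rwa [c.adapted _ h, c.total.right_inv hz] at h2

theorem AdaptedChart.base_symm_fst (c : π.AdaptedChart) {z : V × W} (hz : z ∈ c.total.target) :
    c.base.symm z.1 = π.proj (c.total.symm z) := by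
  have h := c.total.map_target hz
  have h2 := c.adapted _ h
  rw [c.total.right_inv hz] at h2
  rw [← h2, c.base.left_inv (c.mapsTo _ h)]

theorem AdaptedChart.total_section (c : π.AdaptedChart) (s : π.LocalSection) {x : M}
    (hx : x ∈ s.dom) (hs : s.toFun x ∈ c.total.source) :
    x ∈ c.base.source ∧ c.total (s.toFun x) = (c.base x, c.localRep s.toFun (c.base x)) := by
  have h := c.mapsTo _ hs
  have h2 := c.adapted _ hs
  rw [s.isSection x hx] at h h2
  refine ⟨h, Prod.ext h2.symm ?_⟩
  simp [localRep, c.base.left_inv h]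

theorem AdaptedChart.eventually (c : π.AdaptedChart) (p : π.PointedSection)
    (hp : p.value ∈ c.total.source) : ∀ᶠ y in 𝓝 (c.base p.pt), y ∈ c.base.target ∧
      c.base.symm y ∈ p.sec.dom ∧ p.sec.toFun (c.base.symm y) ∈ c.total.source := by
  have hb := (c.total_section p.sec p.mem hp).1
  have h1 : ContinuousAt c.base.symm (c.base p.pt) :=
    c.base.continuousAt_symm (c.base.map_source hb)
  have h3 : ContinuousAt p.sec.toFun (c.base.symm (c.base p.pt)) := by
    rw [c.base.left_inv hb]
    exact p.sec.smooth.continuousOn.continuousAt (p.sec.isOpen_dom.mem_nhds p.mem)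
  have h0 : ∀ᶠ y in 𝓝 (c.base p.pt), y ∈ c.base.target :=
    c.base.open_target.mem_nhds (c.base.map_source hb)
  refine h0.and (Filter.Eventually.and ?_ ?_)
  · refine h1 (p.sec.isOpen_dom.mem_nhds ?_)
    rw [c.base.left_inv hb]; exact p.mem
  · refine (h3.comp h1) (c.total.open_source.mem_nhds ?_)
    simp only [Function.comp, c.base.left_inv hb]; exact hp

theorem AdaptedChart.contDiffAt_localRep (c : π.AdaptedChart) (p : π.PointedSection)
    (hp : p.value ∈ c.total.source) :
    ContDiffAt ℝ ∞ (c.localRep p.sec.toFun) (c.base p.pt) := by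
  have hb := (c.total_section p.sec p.mem hp).1
  have hl := c.base.left_inv hb
  rw [← contMDiffAt_iff_contDiffAt]
  have h1 : ContMDiffAt 𝓘(ℝ, V) 𝓘(ℝ, V) ∞ c.base.symm (c.base p.pt) :=
    c.smooth_base_symm.contMDiffAt (c.base.open_target.mem_nhds (c.base.map_source hb))
  have h2 : ContMDiffAt 𝓘(ℝ, V) 𝓘(ℝ, EE) ∞ p.sec.toFun (c.base.symm (c.base p.pt)) := by
    rw [hl]; exact p.sec.smooth.contMDiffAt (p.sec.isOpen_dom.mem_nhds p.mem)
  have h3 : ContMDiffAt 𝓘(ℝ, EE) 𝓘(ℝ, V × W) ∞ c.total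
      (p.sec.toFun (c.base.symm (c.base p.pt))) := by
    rw [hl]; exact c.smooth_total.contMDiffAt (c.total.open_source.mem_nhds hp)
  exact (contDiff_snd.contMDiff.contMDiffAt).comp (I' := 𝓘(ℝ, V × W)) (c.base p.pt)
    (h3.comp (c.base p.pt) (h2.comp _ h1))

/-- The change of adapted coordinates, as a map of `V × W`. -/
theorem AdaptedChart.contDiffAt_change (c c' : π.AdaptedChart) {z : V × W}
    (hz : z ∈ c.total.target) (hz' : c.total.symm z ∈ c'.total.source) :
    ContDiffAt ℝ ∞ (fun w => c'.total (c.total.symm w)) z := by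
  rw [← contMDiffAt_iff_contDiffAt]
  exact (c'.smooth_total.contMDiffAt (c'.total.open_source.mem_nhds hz')).comp z
    (c.smooth_total_symm.contMDiffAt (c.total.open_target.mem_nhds hz))

theorem AdaptedChart.contDiffAt_baseChange (c c' : π.AdaptedChart) {y : V}
    (hy : y ∈ c.base.target) (hy' : c.base.symm y ∈ c'.base.source) :
    ContDiffAt ℝ ∞ (fun w => c'.base (c.base.symm w)) y := by
  rw [← contMDiffAt_iff_contDiffAt]
  exact (c'.smooth_base.contMDiffAt (c'.base.open_source.mem_nhds hy')).comp y
    (c.smooth_base_symm.contMDiffAt (c.base.open_target.mem_nhds hy))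

/-- Agreement of derivatives up to order `r` in one adapted chart suffices for having the same
`r`-jet. -/
theorem PointedSection.jet_eq_of_chart {p q : π.PointedSection} (hpt : p.pt = q.pt)
    (hv : p.value = q.value) (c : π.AdaptedChart) (hc : p.value ∈ c.total.source)
    (h : AgreeTo r (c.localRep p.sec.toFun) (c.localRep q.sec.toFun) (c.base p.pt)) :
    p.jet r = q.jet r := by
  refine Quotient.sound ⟨hpt, hv, fun c' hc' => ?_⟩
  have hb := (c.total_section p.sec p.mem hc)
  have hb' := (c'.total_section p.sec p.mem hc')
  have hl := c.base.left_inv hb.1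
  have hl' := c'.base.left_inv hb'.1
  let τ : V → V := fun w => c.base (c'.base.symm w)
  have hτ : τ (c'.base p.pt) = c.base p.pt := by simp only [τ, hl']
  have hτs : ContDiffAt ℝ ∞ τ (c'.base p.pt) :=
    c'.contDiffAt_baseChange c (c'.base.map_source hb'.1) (by rw [hl']; exact hb.1)
  let G : V × W → W := fun w => (c'.total (c.total.symm w)).2
  have hGs : ContDiffAt ℝ ∞ G (c.base p.pt, c.localRep p.sec.toFun (c.base p.pt)) := by
    rw [← hb.2]
    exact (c.contDiffAt_change c' (c.total.map_source hc)
      (by rw [c.total.left_inv hc]; exact hc')).snd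
  have key : ∀ p' : π.PointedSection, p'.pt = p.pt → p'.value = p.value →
      c'.localRep p'.sec.toFun =ᶠ[𝓝 (c'.base p.pt)]
        (G ∘ fun y => (y, c.localRep p'.sec.toFun y)) ∘ τ := by
    intro p' hp' hv'
    have e1 := c'.eventually p' (by rw [hv']; exact hc')
    have e2 := c.eventually p' (by rw [hv']; exact hc)
    rw [hp'] at e1 e2
    rw [← hτ] at e2
    filter_upwards [e1, hτs.continuousAt.eventually e2,
      c'.base.continuousAt_symm (c'.base.map_source hb'.1)
        (c.base.open_source.mem_nhds (by rw [hl']; exact hb.1))] with y h1 h2 h3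
    have h4 : c.base.symm (τ y) = c'.base.symm y := c.base.left_inv h3
    rw [h4] at h2
    have h5 := (c.total_section p'.sec h1.2.1 h2.2.2).2
    simp only [Function.comp, G]
    change _ = (c'.total (c.total.symm (c.base (c'.base.symm y), c.localRep p'.sec.toFun
      (c.base (c'.base.symm y))))).2
    rw [← h5, c.total.left_inv h2.2.2]
    rfl
  have hq : q.value ∈ c.total.source := hv ▸ hc
  have sp := c.contDiffAt_localRep p hc
  have sq := c.contDiffAt_localRep q hq
  rw [← hpt] at sq
  have h1 := (h.graph sp sq).comp (contDiffAt_id.prodMk sp) (contDiffAt_id.prodMk sq) hGs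
  have h2 : AgreeTo r ((G ∘ fun y => (y, c.localRep p.sec.toFun y)) ∘ τ)
      ((G ∘ fun y => (y, c.localRep q.sec.toFun y)) ∘ τ) (c'.base p.pt) := by
    refine AgreeTo.comp_right hτs ?_ ?_ (by rw [hτ]; exact h1)
    · rw [hτ]; exact hGs.comp (c.base p.pt) (contDiffAt_id.prodMk sp)
    · rw [hτ]
      exact ContDiffAt.comp (c.base p.pt) (by rw [← h.eq]; exact hGs) (contDiffAt_id.prodMk sq)
  intro j hj
  rw [(Filter.EventuallyEq.iteratedFDeriv ℝ (key p rfl rfl) j).self_of_nhds,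
    (Filter.EventuallyEq.iteratedFDeriv ℝ (key q hpt.symm hv.symm) j).self_of_nhds]
  exact h2 j hj

/-- The induced coordinates `(x^λ, u^i_σ)`, `|σ| ≤ r`, of an `r`-jet in an adapted chart. -/
def AdaptedChart.coord (c : π.AdaptedChart) (r : ℕ) (θ : π.Jet r) : JetModel V W r :=
  (c.base θ.base, fun j => symmetrize j
    (iteratedFDeriv ℝ j (c.localRep θ.rep.sec.toFun) (c.base θ.base)))

theorem AdaptedChart.coord_jet (c : π.AdaptedChart) (p : π.PointedSection)
    (hp : p.value ∈ c.total.source) : c.coord r (p.jet r) = (c.base p.pt, fun j : Fin (r + 1) =>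
      symmetrize j (iteratedFDeriv ℝ j (c.localRep p.sec.toFun) (c.base p.pt))) := by
  have h : SameJet r p (p.jet r).rep := Quotient.exact (s := π.jetSetoid r) (Jet.jet_rep _).symm
  refine Prod.ext rfl (funext fun j => ?_)
  change symmetrize j (iteratedFDeriv ℝ j (c.localRep (p.jet r).rep.sec.toFun) (c.base p.pt)) = _
  exact congrArg _ (h.2.2 c hp j (Nat.lt_succ_iff.1 j.2)).symm

theorem AdaptedChart.incl_coord (c : π.AdaptedChart) (p : π.PointedSection)
    (hp : p.value ∈ c.total.source) (j : Fin (r + 1)) :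
    SymForm.incl j ((c.coord r (p.jet r)).2 j) =
      iteratedFDeriv ℝ j (c.localRep p.sec.toFun) (c.base p.pt) := by
  rw [c.coord_jet p hp]
  exact incl_symmetrize
    (iteratedFDeriv_perm _ ((c.contDiffAt_localRep p hp).of_le (by exact_mod_cast le_top)))

theorem AdaptedChart.value_coord (c : π.AdaptedChart) (θ : π.Jet r)
    (hθ : θ.value ∈ c.total.source) : (c.coord r θ).value = c.total θ.value := by
  obtain ⟨p, rfl⟩ : ∃ p : π.PointedSection, p.jet r = θ := ⟨θ.rep, θ.jet_rep⟩
  have h := (c.total_section p.sec p.mem hθ).2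
  change _ = c.total (p.sec.toFun p.pt)
  rw [h]
  refine Prod.ext rfl ?_
  have h2 := DFunLike.congr_fun (c.incl_coord (r := r) p hθ 0) (fun _ => 0)
  exact h2

/-- The local section whose expression in an adapted chart is the polynomial map with given
jet coordinates. -/
def AdaptedChart.taylorSection (c : π.AdaptedChart) (z : JetModel V W r) : π.LocalSection where
  toFun x := c.total.symm (c.base x, z.taylor (c.base x))
  dom := c.base.source ∩ (fun x => (c.base x, z.taylor (c.base x))) ⁻¹' c.total.target
  isOpen_dom := by
    refine ContinuousOn.isOpen_inter_preimage ?_ c.base.open_source c.total.open_target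
    exact c.base.continuousOn.prodMk ((JetModel.contDiff_taylor.continuous.comp
      (Continuous.prodMk_right z)).comp_continuousOn c.base.continuousOn)
  smooth := by
    refine ContMDiffOn.comp c.smooth_total_symm (f := fun x => (c.base x, z.taylor (c.base x)))
      ?_ inter_subset_right
    have h : ContDiff ℝ ∞ (fun y => (y, z.taylor y)) :=
      contDiff_id.prodMk (JetModel.contDiff_taylor.comp (contDiff_prodMk_right z))
    exact h.contMDiff.comp_contMDiffOn (c.smooth_base.mono inter_subset_left)
  isSection x hx := by
    rw [← c.base_symm_fst hx.2, c.base.left_inv hx.1]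

theorem AdaptedChart.mem_taylorSection (c : π.AdaptedChart) {z : JetModel V W r}
    (hz : z.value ∈ c.total.target) : c.base.symm z.1 ∈ (c.taylorSection z).dom := by
  have h : z.1 ∈ c.base.target := c.mem_target_base hz
  refine ⟨c.base.map_target h, ?_⟩
  simp only [mem_preimage, c.base.right_inv h, z.taylor_self]
  exact hz

/-- The local section with given jet coordinates, at the point where it has them. -/
def AdaptedChart.taylorPointed (c : π.AdaptedChart) (z : JetModel V W r)
    (hz : z.value ∈ c.total.target) : π.PointedSection :=
  ⟨c.taylorSection z, c.base.symm z.1, c.mem_taylorSection hz⟩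

theorem AdaptedChart.value_taylorPointed (c : π.AdaptedChart) (z : JetModel V W r)
    (hz : z.value ∈ c.total.target) : (c.taylorPointed z hz).value = c.total.symm z.value := by
  have h : z.1 ∈ c.base.target := c.mem_target_base hz
  change c.total.symm (c.base (c.base.symm z.1), z.taylor (c.base (c.base.symm z.1))) = _
  rw [c.base.right_inv h, z.taylor_self]
  rfl

theorem AdaptedChart.localRep_taylor (c : π.AdaptedChart) (z : JetModel V W r)
    (hz : z.value ∈ c.total.target) :
    c.localRep (c.taylorSection z).toFun =ᶠ[𝓝 z.1] z.taylor := by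
  have h : z.1 ∈ c.base.target := c.mem_target_base hz
  have hs := c.eventually (c.taylorPointed z hz) (by
    rw [c.value_taylorPointed]; exact c.total.map_target hz)
  change ∀ᶠ y in 𝓝 (c.base (c.base.symm z.1)), _ at hs
  rw [c.base.right_inv h] at hs
  filter_upwards [hs] with y hy
  have h2 := hy.2.1.2
  change (c.total (c.total.symm (c.base (c.base.symm y), z.taylor (c.base (c.base.symm y))))).2 = _
  rw [mem_preimage] at h2
  rw [c.total.right_inv h2]
  change z.taylor (c.base (c.base.symm y)) = _
  rw [c.base.right_inv hy.1]

/-- Some jet through a given point of `E`. -/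
def someJet (e : E) : π.Jet r :=
  ((π.adaptedChartAt e).taylorPointed (JetModel.ofPoint (r := r) ((π.adaptedChartAt e).total e)) (by
    rw [JetModel.value_ofPoint (r := r)]
    exact (π.adaptedChartAt e).total.map_source (π.mem_adaptedChartAt e))).jet r

open Classical in
/-- The chart of `Jʳπ` induced by an adapted chart. -/
def AdaptedChart.jetEquiv (c : π.AdaptedChart) (r : ℕ) :
    PartialEquiv (π.Jet r) (JetModel V W r) where
  toFun := c.coord r
  invFun z := if h : z.value ∈ c.total.target then (c.taylorPointed z h).jet r
    else someJet (c.total.symm z.value)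
  source := {θ | θ.value ∈ c.total.source}
  target := {z | z.value ∈ c.total.target}
  map_source' θ hθ := by
    change (c.coord r θ).value ∈ c.total.target
    rw [c.value_coord θ hθ]
    exact c.total.map_source hθ
  map_target' z hz := by
    have hz' : z.value ∈ c.total.target := hz
    rw [dif_pos hz']
    change (c.taylorPointed z hz').value ∈ c.total.source
    rw [c.value_taylorPointed]
    exact c.total.map_target hz'
  left_inv' θ hθ := by
    obtain ⟨p, rfl⟩ : ∃ p : π.PointedSection, p.jet r = θ := ⟨θ.rep, θ.jet_rep⟩
    have hp : p.value ∈ c.total.source := hθ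
    have hb := c.total_section p.sec p.mem hp
    have hv : (c.coord r (p.jet r)).value = c.total p.value := c.value_coord _ hp
    have hz : (c.coord r (p.jet r)).value ∈ c.total.target := by
      rw [hv]; exact c.total.map_source hp
    rw [dif_pos hz]
    symm
    refine PointedSection.jet_eq_of_chart (c.base.left_inv hb.1).symm ?_ c hp ?_
    · rw [c.value_taylorPointed, hv, c.total.left_inv hp]
    · intro j hj
      rw [← c.incl_coord p hp ⟨j, Nat.lt_succ_of_le hj⟩]
      have h1 := (Filter.EventuallyEq.iteratedFDeriv ℝ (c.localRep_taylor _ hz) j).self_of_nhds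
      have h2 := (c.coord r (p.jet r)).iteratedFDeriv_taylor ⟨j, Nat.lt_succ_of_le hj⟩
      exact (h1.trans h2).symm
  right_inv' z hz := by
    have hz' : z.value ∈ c.total.target := hz
    rw [dif_pos hz']
    have h : z.1 ∈ c.base.target := c.mem_target_base hz'
    have hp : (c.taylorPointed z hz').value ∈ c.total.source := by
      rw [c.value_taylorPointed]; exact c.total.map_target hz'
    refine Prod.ext (c.base.right_inv h) (funext fun j => SymForm.incl_injective _ ?_)
    rw [c.incl_coord _ hp, ← z.iteratedFDeriv_taylor j]
    change iteratedFDeriv ℝ j _ (c.base (c.base.symm z.1)) = _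
    rw [c.base.right_inv h]
    exact (Filter.EventuallyEq.iteratedFDeriv ℝ (c.localRep_taylor z hz') j).self_of_nhds

theorem AdaptedChart.jetEquiv_symm (c : π.AdaptedChart) {z : JetModel V W r}
    (hz : z.value ∈ c.total.target) :
    (c.jetEquiv r).symm z = (c.taylorPointed z hz).jet r := dif_pos hz

theorem AdaptedChart.source_change (c c' : π.AdaptedChart) (r : ℕ) :
    ((c.jetEquiv r).symm.trans (c'.jetEquiv r)).source =
      JetModel.value ⁻¹' (c.total.symm.trans c'.total).source := by
  ext z
  rw [PartialEquiv.trans_source, mem_preimage, OpenPartialHomeomorph.trans_source]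
  refine and_congr_right fun hz => ?_
  have hz' : z.value ∈ c.total.target := hz
  rw [mem_preimage, c.jetEquiv_symm hz']
  change (c.taylorPointed z hz').value ∈ c'.total.source ↔ _
  rw [c.value_taylorPointed]
  rfl

theorem AdaptedChart.contDiffOn_jetChange (c c' : π.AdaptedChart) (r : ℕ) :
    ContDiffOn ℝ ∞ ((c.jetEquiv r).symm.trans (c'.jetEquiv r))
      ((c.jetEquiv r).symm.trans (c'.jetEquiv r)).source := by
  have hopen : IsOpen ((c.jetEquiv r).symm.trans (c'.jetEquiv r)).source := by
    rw [source_change]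
    exact (c.total.symm.trans c'.total).open_source.preimage
      JetModel.contDiff_value.continuous
  let K : JetModel V W r → V → W := fun z y => (c'.total (c.total.symm
    (c.base (c'.base.symm y), z.taylor (c.base (c'.base.symm y))))).2
  let τ : V → V := fun w => c'.base (c.base.symm w)
  have heq : ∀ z ∈ ((c.jetEquiv r).symm.trans (c'.jetEquiv r)).source,
      ((c.jetEquiv r).symm.trans (c'.jetEquiv r)) z =
        (τ z.1, fun j : Fin (r + 1) => symmetrize j (iteratedFDeriv ℝ j (K z) (τ z.1))) := by
    intro z hz
    have hz' : z.value ∈ c.total.target := hz.1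
    have h2 : (c.jetEquiv r).symm z ∈ (c'.jetEquiv r).source := hz.2
    change (c'.jetEquiv r) ((c.jetEquiv r).symm z) = _
    rw [c.jetEquiv_symm hz'] at h2 ⊢
    exact c'.coord_jet _ h2
  refine ContDiffOn.congr ?_ heq
  intro z hz
  refine ContDiffAt.contDiffWithinAt ?_
  have hz' := hz
  rw [source_change] at hz'
  have hz1 : z.value ∈ c.total.target := hz'.1
  have hz2 : c.total.symm z.value ∈ c'.total.source := hz'.2
  have hb : z.1 ∈ c.base.target := c.mem_target_base hz1
  have hb' : c.base.symm z.1 ∈ c'.base.source := by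
    rw [show c.base.symm z.1 = π.proj (c.total.symm z.value) from c.base_symm_fst hz1]
    exact c'.mapsTo _ hz2
  have hτ : ContDiffAt ℝ ∞ τ z.1 := c.contDiffAt_baseChange c' hb hb'
  have hτ' : c'.base.symm (τ z.1) = c.base.symm z.1 := c'.base.left_inv hb'
  have hτ2 : c.base (c'.base.symm (τ z.1)) = z.1 := by rw [hτ', c.base.right_inv hb]
  have hK : ContDiffAt ℝ ∞ (Function.uncurry K) (z, τ z.1) := by
    have h1 : ContDiffAt ℝ ∞ (fun y => c.base (c'.base.symm y)) (τ z.1) :=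
      c'.contDiffAt_baseChange c (c'.base.map_source hb')
        (by rw [hτ']; exact c.base.map_target hb)
    have h2 : ContDiffAt ℝ ∞ (fun q : JetModel V W r × V => c.base (c'.base.symm q.2))
        (z, τ z.1) := ContDiffAt.comp (g := fun y => c.base (c'.base.symm y)) (z, τ z.1) h1 contDiffAt_snd
    have h3 : ContDiffAt ℝ ∞ (fun q : JetModel V W r × V => (c.base (c'.base.symm q.2),
        q.1.taylor (c.base (c'.base.symm q.2)))) (z, τ z.1) :=
      h2.prodMk (JetModel.contDiff_taylor.contDiffAt.comp (z, τ z.1) (contDiffAt_fst.prodMk h2))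
    have h4 : (c.base (c'.base.symm (τ z.1)), z.taylor (c.base (c'.base.symm (τ z.1)))) =
        z.value := by rw [hτ2, z.taylor_self]; rfl
    have h5 : ContDiffAt ℝ ∞ (fun w => (c'.total (c.total.symm w)).2)
        (c.base (c'.base.symm (τ z.1)), z.taylor (c.base (c'.base.symm (τ z.1)))) := by
      rw [h4]; exact (c.contDiffAt_change c' hz1 hz2).snd
    exact ContDiffAt.comp (z, τ z.1) h5 h3
  have hτz : ContDiffAt ℝ ∞ (fun z : JetModel V W r => τ z.1) z :=
    ContDiffAt.comp (g := τ) z hτ contDiffAt_fst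
  refine hτz.prodMk (contDiffAt_pi.2 fun j => ?_)
  exact (symmetrize j).contDiff.contDiffAt.comp z
    ((contDiffAt_iteratedFDeriv_param j hK).comp z (contDiffAt_id.prodMk hτz))

variable (π) in
/-- The smooth atlas of `Jʳπ` that consists of all the charts induced by adapted charts. -/
def jetCore (r : ℕ) : ChartedSpaceCore (JetModel V W r) (π.Jet r) where
  atlas := range fun c : π.AdaptedChart => c.jetEquiv r
  chartAt θ := (π.adaptedChartAt θ.value).jetEquiv r
  mem_chart_source θ := π.mem_adaptedChartAt θ.value
  chart_mem_atlas θ := mem_range_self _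
  open_source := by
    rintro _ _ ⟨c, rfl⟩ ⟨c', rfl⟩
    rw [AdaptedChart.source_change]
    exact (c.total.symm.trans c'.total).open_source.preimage JetModel.contDiff_value.continuous
  continuousOn_toFun := by
    rintro _ _ ⟨c, rfl⟩ ⟨c', rfl⟩
    exact (c.contDiffOn_jetChange c' r).continuousOn

instance (r : ℕ) : TopologicalSpace (π.Jet r) := (π.jetCore r).toTopologicalSpace

instance (r : ℕ) : ChartedSpace (JetModel V W r) (π.Jet r) := (π.jetCore r).toChartedSpace

/-- The induced chart of `Jʳπ`, as an open partial homeomorphism. -/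
def AdaptedChart.jetChart (c : π.AdaptedChart) (r : ℕ) :
    OpenPartialHomeomorph (π.Jet r) (JetModel V W r) :=
  (π.jetCore r).openPartialHomeomorph (c.jetEquiv r) (mem_range_self c)

theorem mem_atlas_jet {e : OpenPartialHomeomorph (π.Jet r) (JetModel V W r)} :
    e ∈ atlas (JetModel V W r) (π.Jet r) ↔ ∃ c : π.AdaptedChart, c.jetChart r = e := by
  change e ∈ ⋃ (e : PartialEquiv (π.Jet r) (JetModel V W r)) (he : e ∈ (π.jetCore r).atlas),
    {(π.jetCore r).openPartialHomeomorph e he} ↔ _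
  simp only [mem_iUnion, mem_singleton_iff]
  constructor
  · rintro ⟨_, ⟨c, rfl⟩, rfl⟩; exact ⟨c, rfl⟩
  · rintro ⟨c, rfl⟩; exact ⟨_, mem_range_self c, rfl⟩

instance (r : ℕ) : IsManifold 𝓘(ℝ, JetModel V W r) ∞ (π.Jet r) := by
  refine isManifold_of_contDiffOn _ _ _ fun e e' he he' => ?_
  obtain ⟨c, rfl⟩ := mem_atlas_jet.1 he
  obtain ⟨c', rfl⟩ := mem_atlas_jet.1 he'
  have h := c.contDiffOn_jetChange c' r
  simp only [mfld_simps]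
  exact h

open Classical in
/-- The prolongation `j_r s` of a local section `s`. (Outside the domain of `s` the value is
irrelevant.) -/
def LocalSection.prolong (s : π.LocalSection) (r : ℕ) (x : M) : π.Jet r :=
  if h : x ∈ s.dom then (PointedSection.mk s x h).jet r else someJet (s.toFun x)


/-! ### Well-definedness of the contact map -/

theorem LocalSection.prolong_of_mem (s : π.LocalSection) {x : M} (hx : x ∈ s.dom) :
    s.prolong r x = (PointedSection.mk s x hx).jet r := dif_pos hx

/-- The coordinate expression of the prolongation `j_r s`. -/
def AdaptedChart.prolongRep (c : π.AdaptedChart) (s : M → E) (r : ℕ) (y : V) : JetModel V W r :=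
  (y, fun j : Fin (r + 1) => symmetrize j (iteratedFDeriv ℝ j (c.localRep s) y))

theorem AdaptedChart.prolong_eventuallyEq (c : π.AdaptedChart) (p : π.PointedSection)
    (hp : p.value ∈ c.total.source) :
    p.sec.prolong r =ᶠ[𝓝 p.pt]
      (c.jetChart r).symm ∘ c.prolongRep p.sec.toFun r ∘ c.base := by
  have h1 : ∀ᶠ x in 𝓝 p.pt, x ∈ p.sec.dom := p.sec.isOpen_dom.mem_nhds p.mem
  have h2 : ∀ᶠ x in 𝓝 p.pt, p.sec.toFun x ∈ c.total.source :=
    (p.sec.smooth.continuousOn.continuousAt h1) (c.total.open_source.mem_nhds hp)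
  filter_upwards [h1, h2] with x hx hx'
  let q : π.PointedSection := ⟨p.sec, x, hx⟩
  have hq : q.jet r ∈ (c.jetEquiv r).source := hx'
  have h3 : c.coord r (q.jet r) = c.prolongRep p.sec.toFun r (c.base x) := c.coord_jet q hx'
  rw [p.sec.prolong_of_mem hx]
  change q.jet r = (c.jetEquiv r).symm (c.prolongRep p.sec.toFun r (c.base x))
  rw [← h3]
  exact ((c.jetEquiv r).left_inv hq).symm

theorem AdaptedChart.hasFDerivAt_prolongRep (c : π.AdaptedChart) (p : π.PointedSection)
    (hp : p.value ∈ c.total.source) :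
    HasFDerivAt (c.prolongRep p.sec.toFun r)
      ((ContinuousLinearMap.id ℝ V).prod (ContinuousLinearMap.pi fun j : Fin (r + 1) =>
        (symmetrize j).comp (fderiv ℝ (iteratedFDeriv ℝ j (c.localRep p.sec.toFun))
          (c.base p.pt)))) (c.base p.pt) := by
  refine (hasFDerivAt_id _).prodMk (hasFDerivAt_pi.2 fun j => ?_)
  refine (symmetrize (V := V) (W := W) (j : ℕ)).hasFDerivAt.comp (c.base p.pt) (DifferentiableAt.hasFDerivAt ?_)
  exact ((c.contDiffAt_localRep p hp).iteratedFDeriv_right (m := 1) (i := j)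
    (by exact_mod_cast le_top)).differentiableAt (by simp)

/-- The differential of `j_r s` at `x` depends only on `j_{r+1} s (x)`. -/
theorem mfderiv_prolong_eq {p q : π.PointedSection} (h : p.jet (r + 1) = q.jet (r + 1)) :
    (mfderiv 𝓘(ℝ, V) 𝓘(ℝ, JetModel V W r) (p.sec.prolong r) p.pt : V →L[ℝ] JetModel V W r) =
      mfderiv 𝓘(ℝ, V) 𝓘(ℝ, JetModel V W r) (q.sec.prolong r) q.pt := by
  have hpq : SameJet (r + 1) p q := Quotient.exact (s := π.jetSetoid (r + 1)) h
  let c := π.adaptedChartAt p.value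
  have hp : p.value ∈ c.total.source := π.mem_adaptedChartAt _
  have hq : q.value ∈ c.total.source := hpq.2.1 ▸ hp
  have hagree := hpq.2.2 c hp
  have hb := (c.total_section p.sec p.mem hp).1
  have h0 : c.prolongRep p.sec.toFun r (c.base p.pt) = c.prolongRep q.sec.toFun r (c.base p.pt) :=
    Prod.ext rfl (funext fun j => congrArg (symmetrize (j : ℕ)) (hagree j (by omega)))
  have h1 := c.hasFDerivAt_prolongRep (r := r) p hp
  have h2 := c.hasFDerivAt_prolongRep (r := r) q hq
  have h3 : ∀ j : Fin (r + 1), fderiv ℝ (iteratedFDeriv ℝ j (c.localRep p.sec.toFun))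
      (c.base p.pt) = fderiv ℝ (iteratedFDeriv ℝ j (c.localRep q.sec.toFun)) (c.base q.pt) := by
    intro j
    ext v w
    have := DFunLike.congr_fun (hagree (j + 1) (by omega)) (Fin.cons v w)
    rw [iteratedFDeriv_succ_apply_left, iteratedFDeriv_succ_apply_left, hpq.1] at this
    rw [hpq.1]
    simpa using this
  have key : ∀ p' : π.PointedSection, p'.pt = p.pt → p'.value ∈ c.total.source →
      mfderiv 𝓘(ℝ, V) 𝓘(ℝ, JetModel V W r) (p'.sec.prolong r) p.pt =
        (mfderiv 𝓘(ℝ, JetModel V W r) 𝓘(ℝ, JetModel V W r) (c.jetChart r).symm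
          (c.prolongRep p'.sec.toFun r (c.base p.pt)) : JetModel V W r →L[ℝ] JetModel V W r).comp
        ((fderiv ℝ (c.prolongRep p'.sec.toFun r) (c.base p.pt)).comp
          (mfderiv 𝓘(ℝ, V) 𝓘(ℝ, V) c.base p.pt : V →L[ℝ] V)) := by
    intro p' hp' hv'
    have e := c.prolong_eventuallyEq (r := r) p' hv'
    rw [hp'] at e
    rw [e.mfderiv_eq]
    have d1 : HasMFDerivAt 𝓘(ℝ, V) 𝓘(ℝ, V) c.base p.pt (mfderiv 𝓘(ℝ, V) 𝓘(ℝ, V) c.base p.pt) :=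
      ((c.smooth_base.contMDiffAt (c.base.open_source.mem_nhds hb)).mdifferentiableAt
        (by simp)).hasMFDerivAt
    have d2 : HasMFDerivAt 𝓘(ℝ, V) 𝓘(ℝ, JetModel V W r) (c.prolongRep p'.sec.toFun r)
        (c.base p.pt) (fderiv ℝ (c.prolongRep p'.sec.toFun r) (c.base p.pt)) := by
      have := (c.hasFDerivAt_prolongRep (r := r) p' hv').differentiableAt
      rw [hp'] at this
      exact this.hasFDerivAt.hasMFDerivAt
    have hmem : c.prolongRep p'.sec.toFun r (c.base p.pt) ∈ (c.jetChart r).target := by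
      rw [← hp']
      have h5 : c.coord r (p'.jet r) = c.prolongRep p'.sec.toFun r (c.base p'.pt) :=
        c.coord_jet p' hv'
      rw [← h5]
      exact (c.jetEquiv r).map_source hv'
    have d3 := ((contMDiffOn_symm_of_mem_maximalAtlas (I := 𝓘(ℝ, JetModel V W r)) (n := ∞)
      (IsManifold.subset_maximalAtlas (mem_atlas_jet.2 ⟨c, rfl⟩))).contMDiffAt
        ((c.jetChart r).open_target.mem_nhds hmem)).mdifferentiableAt (by simp) |>.hasMFDerivAt
    exact (d3.comp p.pt (d2.comp p.pt d1)).mfderiv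
  rw [key p rfl hp, ← hpq.1, key q hpq.1.symm hq, h0, h1.fderiv, hpq.1, h2.fderiv]
  simp only [← hpq.1] at h3 ⊢
  simp only [h3]
  rfl

end FibredManifold

end Geometry

/-! ### Differential forms -/

section Forms

/-- A (not necessarily smooth) field of alternating `k`-forms on a manifold `N`. -/
abbrev FormField (F N : Type*) [NormedAddCommGroup F] [NormedSpace ℝ F] [TopologicalSpace N]
    [ChartedSpace F N] (k : ℕ) : Type _ :=
  ∀ p : N, TangentSpace 𝓘(ℝ, F) p [⋀^Fin k]→L[ℝ] ℝ

variable {F F' N N' : Type*} [NormedAddCommGroup F] [NormedSpace ℝ F] [NormedAddCommGroup F']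
  [NormedSpace ℝ F'] [TopologicalSpace N] [ChartedSpace F N] [TopologicalSpace N']
  [ChartedSpace F' N'] {k : ℕ}

/-- The pull-back `f^* η`. -/
def pullback (f : N → N') (η : FormField F' N' k) : FormField F N k := fun p =>
  (η (f p)).compContinuousLinearMap (mfderiv 𝓘(ℝ, F) 𝓘(ℝ, F') f p)

/-- The expression of a field of forms in a chart. -/
def chartRep (e : OpenPartialHomeomorph N F) (η : FormField F N k) (z : F) : F [⋀^Fin k]→L[ℝ] ℝ :=
  pullback (F := F) (N := F) e.symm η z

variable (F N k) in
/-- The smooth `k`-forms on `N`. -/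
def smoothForms : Set (FormField F N k) :=
  {η | ∀ e ∈ atlas F N, ContDiffOn ℝ ∞ (chartRep e η) e.target}

/-- A map between vector spaces is polynomial of degree at most `k` if it is a sum of
homogeneous terms `q ↦ L j (q, …, q)` with `L j` multilinear in `j ≤ k` variables. -/
def IsPolynomialOfDegreeLE (k : ℕ) (f : F → F') : Prop :=
  ∃ L : ∀ j : Fin (k + 1), F [×j]→L[ℝ] F', ∀ q, f q = ∑ j, L j fun _ => q

end Forms

section Horizontal

variable {V W EE M E : Type*}
  [NormedAddCommGroup V] [NormedSpace ℝ V] [NormedAddCommGroup W] [NormedSpace ℝ W]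
  [NormedAddCommGroup EE] [NormedSpace ℝ EE]
  [TopologicalSpace M] [ChartedSpace V M] [TopologicalSpace E] [ChartedSpace EE E]
  (π : FibredManifold V W EE M E)

namespace FibredManifold

/-- The `k`-forms `Λ^k_r` on `Jʳπ`. -/
def forms (r k : ℕ) : Set (FormField (JetModel V W r) (π.Jet r) k) :=
  smoothForms (JetModel V W r) (π.Jet r) k

/-- The horizontal `k`-forms on `Jʳπ`: those that vanish as soon as one of their arguments is
vertical over `M`, that is, the forms with values in `⋀ᵏ T^* M`. -/
def horizontalForms (r k : ℕ) : Set (FormField (JetModel V W r) (π.Jet r) k) :=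
  {α | α ∈ π.forms r k ∧ ∀ (θ : π.Jet r) (v : Fin k → TangentSpace 𝓘(ℝ, JetModel V W r) θ)
    (i : Fin k), mfderiv 𝓘(ℝ, JetModel V W r) 𝓘(ℝ, V) (Jet.base (π := π)) θ (v i) = 0 →
      α θ v = 0}

/-- The horizontal `k`-forms on `J^{r+1}π` that are polynomial of degree at most `k` along the
affine fibres of `J^{r+1}π → Jʳπ`. In the chart induced by an adapted chart, such a fibre is
obtained by fixing `(x, u, …, Dʳu)` and letting the derivatives `q` of order `r + 1` vary; the
coordinates `q` are affine coordinates of the fibre. -/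
def polynomialHorizontalForms (r k : ℕ) :
    Set (FormField (JetModel V W (r + 1)) (π.Jet (r + 1)) k) :=
  {α | α ∈ π.horizontalForms (r + 1) k ∧ ∀ (c : π.AdaptedChart),
    ∀ z ∈ (c.jetChart (r + 1)).target,
      IsPolynomialOfDegreeLE k (fun q : SymForm V W (Fin.last (r + 1)) =>
        chartRep (c.jetChart (r + 1)) α (z.1, Function.update z.2 (Fin.last (r + 1)) q))}

variable {π} in
/-- The contact map `D_{r+1}` at `θ ∈ J^{r+1}π`: the linear map `T_x M → T Jʳπ` which is the
differential of `j_r s` at `x`, for any section `s` with `j_{r+1} s (x) = θ`. -/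
def contactMap {r : ℕ} (θ : π.Jet (r + 1)) :
    TangentSpace 𝓘(ℝ, V) θ.base →L[ℝ] TangentSpace 𝓘(ℝ, JetModel V W r) θ.proj :=
  mfderiv 𝓘(ℝ, V) 𝓘(ℝ, JetModel V W r) (θ.rep.sec.prolong r) θ.rep.pt

variable {π} in
/-- The horizontalization `h β` of `β ∈ Λ^k_r`: the form `β` is regarded as a form along
`J^{r+1}π → Jʳπ`, and all its arguments are contracted with `D_{r+1}`. -/
def horizontalization {r k : ℕ} (β : FormField (JetModel V W r) (π.Jet r) k) :
    FormField (JetModel V W (r + 1)) (π.Jet (r + 1)) k := fun θ =>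
  (β θ.proj).compContinuousLinearMap
    ((contactMap θ).comp (mfderiv 𝓘(ℝ, JetModel V W (r + 1)) 𝓘(ℝ, V) (Jet.base (π := π)) θ))

/-- The image `h(Λ^k_r)`. -/
def horizontalImage (r k : ℕ) : Set (FormField (JetModel V W (r + 1)) (π.Jet (r + 1)) k) :=
  horizontalization '' π.forms r k

variable {π} in
/-- The pull-back `(j_r s)^* η` of a form on `Jʳπ` along the prolongation of a local section `s`;
it is meaningful at the points of the domain of `s`. -/
def LocalSection.pullbackForm (s : π.LocalSection) (r : ℕ) {k : ℕ}
    (η : FormField (JetModel V W r) (π.Jet r) k) : FormField V M k :=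
  pullback (F := V) (F' := JetModel V W r) (s.prolong r) η

end FibredManifold

end Horizontal

end FibredJet

end

/-! In an induced chart the contact map at a jet with coordinates `z = (x, u, Du, …, D^{r+1}u)` is
`v ↦ (v, Du·v, D²u(v, ·), …, D^{r+1}u(v, ·, …))`. This map, `JetModel.contact z`, is affine in the
derivatives, in particular in those of order `r + 1`. The coordinate expression of `h β` at `z` is
the expression of `β` at the truncated jet, pulled back along `contact z` composed with the
projection to `V` (`chartRep_horizontalization`).

The inclusion is read off from this formula. Along a fibre of `J^{r+1}π → Jʳπ` the truncated jet is
constant, so the coefficient coming from `β` is fixed. The pull-back of a fixed alternating `k`-form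
along a linear map `A` is the diagonal of a `k`-linear map in `A`, and inserting an affine function
of the top derivatives gives a polynomial of degree at most `k`. Smoothness comes from the same
formula, and horizontality from the factor `Tπ^{r+1}` in the definition of `h`. The module
properties hold because `h` is linear at each point and evaluates `β` at `θ.proj`.

The characterization rests on two facts about prolongations. The first is `(j_{r+1}s)^* h β = (j_r
s)^* β` (`pullbackForm_horizontalization`): the contact map at `j_{r+1}s(x)` is `T_x(j_r s)`, and
`Tπ^{r+1} ∘ T(j_{r+1}s)` is the identity. The second is that a horizontal form is determined by its
pull-backs along prolongations (`eq_of_pullbackForm_eq`): every jet is the jet of some section, and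
the differential of the prolongation splits the projection to `TM`. So a `β` with the required
pull-backs satisfies `h β = α`. -/

noncomputable section

namespace FibredJet

open Set

/-! ### Multilinear algebra: pull-back of alternating forms as a polynomial in the linear map. -/

section Alternating

variable {F F' G : Type*} [NormedAddCommGroup F] [NormedSpace ℝ F]
  [NormedAddCommGroup F'] [NormedSpace ℝ F'] [NormedAddCommGroup G] [NormedSpace ℝ G] {k : ℕ}

/-- The projection of the `k`-linear forms onto the alternating ones. -/
def antisymmetrize (F : Type*) [NormedAddCommGroup F] [NormedSpace ℝ F] (k : ℕ) :
    (F [×k]→L[ℝ] ℝ) →L[ℝ] (F [⋀^Fin k]→L[ℝ] ℝ) where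
  toFun g := (k.factorial : ℝ)⁻¹ • ContinuousMultilinearMap.alternatization g
  map_add' g g' := by rw [map_add, smul_add]
  map_smul' t g := by
    ext v
    simp only [ContinuousAlternatingMap.smul_apply,
      ContinuousMultilinearMap.alternatization_apply_apply, RingHom.id_apply,
      smul_apply, smul_eq_mul, Finset.mul_sum, Units.smul_def,
      zsmul_eq_mul]
    exact Finset.sum_congr rfl fun σ _ => by ring
  cont := by
    suffices hc : Continuous fun g : F [×k]→L[ℝ] ℝ =>
        ContinuousMultilinearMap.alternatization g from hc.const_smul (k.factorial : ℝ)⁻¹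
    -- Alternating forms carry the topology induced from multilinear forms, where alternatization is
    -- a finite signed sum of isometries.
    rw [ContinuousAlternatingMap.isEmbedding_toContinuousMultilinearMap.continuous_iff]
    have h : ∀ g : F [×k]→L[ℝ] ℝ,
        (ContinuousMultilinearMap.alternatization g).toContinuousMultilinearMap =
          ∑ σ : Equiv.Perm (Fin k), Equiv.Perm.sign σ •
            ContinuousMultilinearMap.domDomCongrₗᵢ ℝ F ℝ σ g := fun g => rfl
    simp only [Function.comp_def, h]
    refine continuous_finsetSum _ fun σ _ => ?_
    simp only [Units.smul_def]
    exact (LinearIsometryEquiv.continuous _).const_smul _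

/-- All `k!` terms of the alternatization equal `g v`, which the factor `1 / k!` compensates. This
continuous left inverse of the inclusion carries facts about multilinear forms over to alternating
ones. -/
theorem antisymmetrize_toContinuousMultilinearMap (g : F [⋀^Fin k]→L[ℝ] ℝ) :
    antisymmetrize F k g.toContinuousMultilinearMap = g := by
  ext v
  change (k.factorial : ℝ)⁻¹ • ContinuousMultilinearMap.alternatization
    g.toContinuousMultilinearMap v = g v
  rw [ContinuousMultilinearMap.alternatization_apply_apply]
  have h : ∀ σ : Equiv.Perm (Fin k), Equiv.Perm.sign σ •
      g.toContinuousMultilinearMap (v ∘ σ) = g v := fun σ => by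
    have h' := g.toAlternatingMap.map_perm v σ
    change Equiv.Perm.sign σ • g.toAlternatingMap (v ∘ σ) = g.toAlternatingMap v
    rw [h', smul_smul, Int.units_mul_self, one_smul]
  rw [Finset.sum_congr rfl fun σ _ => h σ, Finset.sum_const, Finset.card_univ,
    Fintype.card_perm, Fintype.card_fin, ← Nat.cast_smul_eq_nsmul ℝ, smul_smul,
    inv_mul_cancel₀ (by exact_mod_cast Nat.factorial_ne_zero k), one_smul]

/-- For fixed `g`, the pull-back of an alternating form `g` along a linear map `A` is the diagonal
of a multilinear map in `A`. -/
theorem exists_multilinear_compContinuousLinearMap (g : F' [⋀^Fin k]→L[ℝ] ℝ) :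
    ∃ m : (F →L[ℝ] F') [×k]→L[ℝ] (F [⋀^Fin k]→L[ℝ] ℝ),
      ∀ A, g.compContinuousLinearMap A = m fun _ => A := by
  -- The form `g(A₁ ·, …, A_k ·)` is multilinear in the `A_i` but need not be alternating in its
  -- arguments when the `A_i` differ, hence the antisymmetrization. On the diagonal the form is
  -- already alternating and nothing changes.
  refine ⟨((antisymmetrize F k).comp (ContinuousLinearMap.apply ℝ (F [×k]→L[ℝ] ℝ)
    g.toContinuousMultilinearMap)).compContinuousMultilinearMap
      (ContinuousMultilinearMap.compContinuousLinearMapContinuousMultilinear ℝ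
        (fun _ : Fin k => F) (fun _ : Fin k => F') ℝ), fun A => ?_⟩
  exact (antisymmetrize_toContinuousMultilinearMap (g.compContinuousLinearMap A)).symm

/-- For multilinear forms, composition is jointly polynomial in the form and the linear maps; the
continuous linear map `antisymmetrize` brings the result back to alternating forms. -/
theorem contDiff_compContinuousLinearMap :
    ContDiff ℝ ∞ (fun q : (F' [⋀^Fin k]→L[ℝ] ℝ) × (F →L[ℝ] F') =>
      q.1.compContinuousLinearMap q.2) := by
  have h : ∀ q : (F' [⋀^Fin k]→L[ℝ] ℝ) × (F →L[ℝ] F'), q.1.compContinuousLinearMap q.2 =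
      antisymmetrize F k (q.1.toContinuousMultilinearMap.compContinuousLinearMap
        fun _ => q.2) := fun q =>
    (antisymmetrize_toContinuousMultilinearMap (q.1.compContinuousLinearMap q.2)).symm
  simp only [h]
  refine (antisymmetrize F k).contDiff.comp ?_
  have h1 : ContDiff ℝ ∞ (fun p : (Fin k → F →L[ℝ] F') × (F' [×k]→L[ℝ] ℝ) =>
      p.2.compContinuousLinearMap p.1) := contDiff_iff_contDiffAt.2 fun p =>
    ContinuousMultilinearMap.cpolynomialAt_uncurry_compContinuousLinearMap.contDiffAt
  exact h1.comp ((contDiff_pi.2 fun _ => contDiff_snd).prodMk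
    ((ContinuousAlternatingMap.toContinuousMultilinearMapCLM ℝ).contDiff.comp contDiff_fst))

/-- A homogeneous polynomial of degree `k` composed with an affine map is a polynomial of degree
at most `k`. -/
theorem isPolynomialOfDegreeLE_multilinear_affine (m : F' [×k]→L[ℝ] G) (a : F')
    (B : F →L[ℝ] F') : IsPolynomialOfDegreeLE k fun q => m fun _ => a + B q := by
  -- `p` is the Taylor series of `m` at the diagonal point `(a, …, a)`, and `D q = (B q, …, B q)` is
  -- the displacement from it.
  let p := m.toFormalMultilinearSeries.changeOrigin fun _ => a
  let D : F →L[ℝ] (Fin k → F') := ContinuousLinearMap.pi fun _ => B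
  refine ⟨fun j => (p j).compContinuousLinearMap fun _ => D, fun q => ?_⟩
  -- A `k`-linear map has a finite power series, and recentring does not raise its degree; the `k +
  -- 1` terms of the partial sum are those of degrees `0, …, k`.
  have h := (m.hasFiniteFPowerSeriesOnBall.changeOrigin (y := fun _ => a)
    (by simp)).eq_partialSum' (fun _ => a + B q) (by simp) (k + 1) (by simp)
  refine h.trans ?_
  rw [FormalMultilinearSeries.partialSum, Finset.sum_range]
  refine Finset.sum_congr rfl fun j _ => ?_
  rw [ContinuousMultilinearMap.compContinuousLinearMap_apply]
  congr 1
  funext _ i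
  simp [D]

/-- A multilinear form that vanishes as soon as one argument is in the kernel of `P` depends only
on the images of its arguments under `P`. -/
theorem multilinear_eq_of_horizontal {H : Type*} [AddCommGroup H] [Module ℝ H] {H' : Type*}
    [AddCommGroup H'] [Module ℝ H'] {ι : Type*} [Fintype ι]
    (f : MultilinearMap ℝ (fun _ : ι => H) ℝ) (P : H →ₗ[ℝ] H')
    (hf : ∀ v i, P (v i) = 0 → f v = 0) {v w : ι → H} (h : ∀ i, P (v i) = P (w i)) :
    f v = f w := by
  classical
  have e : f w = f (v + (w - v)) := by rw [add_sub_cancel]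
  -- Expanding over subsets, every term except `f v` has some argument `w i - v i`, which lies in
  -- the kernel of `P`.
  rw [e, f.map_add_univ, Finset.sum_eq_single_of_mem Finset.univ (Finset.mem_univ _),
    Finset.piecewise_univ]
  intro s _ hs
  obtain ⟨i, hi⟩ : ∃ i, i ∉ s := by
    by_contra! hall
    exact hs (Finset.eq_univ_of_forall hall)
  refine hf _ i ?_
  rw [Finset.piecewise_eq_of_notMem _ _ _ hi]
  simp [h i]

end Alternating

/-! ### The contact map in jet coordinates. -/

section ContactModel

variable {V W : Type*} [NormedAddCommGroup V] [NormedSpace ℝ V]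
  [NormedAddCommGroup W] [NormedSpace ℝ W] {r : ℕ}

/-- The coordinate expression of the projection `J^{r+1}π → Jʳπ`. -/
def JetModel.truncate (z : JetModel V W (r + 1)) : JetModel V W r :=
  (z.1, fun j : Fin (r + 1) => z.2 j.castSucc)

theorem JetModel.contDiff_truncate :
    ContDiff ℝ ∞ (JetModel.truncate : JetModel V W (r + 1) → JetModel V W r) :=
  contDiff_fst.prodMk (contDiff_pi.2 fun j : Fin (r + 1) =>
    (ContinuousLinearMap.proj (R := ℝ) (φ := fun i : Fin (r + 2) => SymForm V W i)
      j.castSucc).contDiff.comp contDiff_snd)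

/-- The linear part of the coordinate expression of the contact map. -/
def JetModel.contactLinear (V W : Type*) [NormedAddCommGroup V] [NormedSpace ℝ V]
    [NormedAddCommGroup W] [NormedSpace ℝ W] (r : ℕ) :
    (∀ j : Fin (r + 2), SymForm V W j) →L[ℝ] V →L[ℝ] JetModel V W r :=
  -- The component of order `j` of the output reads the derivative of order `j + 1`, hence `j.succ`,
  -- with its first argument split off. What remains is already symmetric, so `symmetrize` only
  -- moves it into `SymForm`.
  ∑ j : Fin (r + 1),
    (ContinuousLinearMap.compL ℝ V (SymForm V W j) (JetModel V W r)
      ((ContinuousLinearMap.inr ℝ V (∀ i : Fin (r + 1), SymForm V W i)).comp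
        (ContinuousLinearMap.single ℝ (fun i : Fin (r + 1) => SymForm V W i) j))).comp
    ((ContinuousLinearMap.compL ℝ V (V [×(j : ℕ)]→L[ℝ] W) (SymForm V W j)
      (symmetrize (j : ℕ))).comp
    (((continuousMultilinearCurryLeftEquiv ℝ (fun _ : Fin ((j : ℕ) + 1) => V)
      W).toContinuousLinearEquiv : (V [×((j : ℕ) + 1)]→L[ℝ] W) →L[ℝ] _).comp
    ((SymForm.incl ((j : ℕ) + 1)).comp
      (ContinuousLinearMap.proj (R := ℝ) (φ := fun i : Fin (r + 2) => SymForm V W i) j.succ))))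

/-- The coordinate expression of the contact map. -/
def JetModel.contact (z : JetModel V W (r + 1)) : V →L[ℝ] JetModel V W r :=
  ContinuousLinearMap.inl ℝ V _ + JetModel.contactLinear V W r z.2

theorem JetModel.contact_apply (z : JetModel V W (r + 1)) (v : V) :
    z.contact v = (v, fun j : Fin (r + 1) =>
      symmetrize (j : ℕ) ((SymForm.incl ((j : ℕ) + 1) (z.2 j.succ)).curryLeft v)) := by
  have h : z.contact v = (v, 0) + ∑ j : Fin (r + 1), ((0 : V),
      Pi.single (M := fun i : Fin (r + 1) => SymForm V W i) j (symmetrize (j : ℕ)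
        ((SymForm.incl ((j : ℕ) + 1) (z.2 j.succ)).curryLeft v))) := by
    simp only [contact, contactLinear, add_apply,
      sum_apply]
    rfl
  rw [h]
  refine Prod.ext (by simp [Prod.fst_sum]) ?_
  rw [Prod.snd_add, Prod.snd_sum, zero_add]
  exact Finset.univ_sum_single (M := fun i : Fin (r + 1) => SymForm V W i) _

theorem JetModel.contDiff_contact :
    ContDiff ℝ ∞ (JetModel.contact : JetModel V W (r + 1) → V →L[ℝ] JetModel V W r) :=
  contDiff_const.add ((JetModel.contactLinear V W r).contDiff.comp contDiff_snd)

/-- This affine dependence on the top derivatives, for fixed lower ones, is the source of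
polynomiality along the fibres. -/
theorem JetModel.contact_update (z : JetModel V W (r + 1))
    (q : SymForm V W (Fin.last (r + 1))) :
    JetModel.contact (z.1, Function.update z.2 (Fin.last (r + 1)) q) =
      JetModel.contact (z.1, Function.update z.2 (Fin.last (r + 1)) 0) +
        (JetModel.contactLinear V W r).comp (ContinuousLinearMap.single ℝ
          (fun i : Fin (r + 2) => SymForm V W i) (Fin.last (r + 1))) q := by
  have h : Function.update z.2 (Fin.last (r + 1)) q =
      Function.update z.2 (Fin.last (r + 1)) 0 +
        Pi.single (M := fun i : Fin (r + 2) => SymForm V W i) (Fin.last (r + 1)) q := by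
    funext i
    by_cases hi : i = Fin.last (r + 1)
    · subst hi; simp
    · simp [hi]
  simp only [contact]
  rw [h, map_add, ← add_assoc]
  rfl

/-- Truncation forgets exactly the top slot, so a form pulled up from order `r` has constant
coefficients along the fibres. -/
theorem JetModel.truncate_update (z : JetModel V W (r + 1))
    (q : SymForm V W (Fin.last (r + 1))) :
    JetModel.truncate (z.1, Function.update z.2 (Fin.last (r + 1)) q) = z.truncate := by
  refine Prod.ext rfl (funext fun j : Fin (r + 1) => ?_)
  exact Function.update_of_ne (Fin.castSucc_ne_last j) _ _

theorem JetModel.value_truncate (z : JetModel V W (r + 1)) : z.truncate.value = z.value := rfl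

end ContactModel

namespace FibredManifold

/-! ### Jet projections in induced charts. -/

section Geometry

variable {V W EE M E : Type*}
  [NormedAddCommGroup V] [NormedSpace ℝ V] [NormedAddCommGroup W] [NormedSpace ℝ W]
  [NormedAddCommGroup EE] [NormedSpace ℝ EE]
  [TopologicalSpace M] [ChartedSpace V M] [TopologicalSpace E] [ChartedSpace EE E]
  {π : FibredManifold V W EE M E} {r k : ℕ}

theorem AdaptedChart.coord_proj (c : π.AdaptedChart) (θ : π.Jet (r + 1))
    (hθ : θ.value ∈ c.total.source) : c.coord r θ.proj = (c.coord (r + 1) θ).truncate := by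
  obtain ⟨p, rfl⟩ : ∃ p : π.PointedSection, p.jet (r + 1) = θ := ⟨θ.rep, θ.jet_rep⟩
  change c.coord r (p.jet r) = _
  rw [c.coord_jet p hθ, c.coord_jet p hθ]
  rfl

theorem AdaptedChart.jetChart_symm_truncate (c : π.AdaptedChart) {z : JetModel V W (r + 1)}
    (hz : z ∈ (c.jetChart (r + 1)).target) :
    (c.jetChart r).symm z.truncate = ((c.jetChart (r + 1)).symm z).proj := by
  have h : ((c.jetChart (r + 1)).symm z).value ∈ c.total.source :=
    (c.jetChart (r + 1)).map_target hz
  have h1 := c.coord_proj _ h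
  have h2 : c.coord (r + 1) ((c.jetChart (r + 1)).symm z) = z :=
    (c.jetChart (r + 1)).right_inv hz
  rw [h2] at h1
  rw [← h1]
  have h' : ((c.jetChart (r + 1)).symm z).proj ∈ (c.jetChart r).source := by
    obtain ⟨p, hp⟩ : ∃ p : π.PointedSection, p.jet (r + 1) = (c.jetChart (r + 1)).symm z :=
      ⟨_, Jet.jet_rep _⟩
    rw [← hp] at h ⊢
    exact h
  exact (c.jetChart r).left_inv h'

theorem AdaptedChart.base_mem (c : π.AdaptedChart) {θ : π.Jet r}
    (hθ : θ ∈ (c.jetChart r).source) : θ.base ∈ c.base.source := by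
  obtain ⟨p, rfl⟩ : ∃ p : π.PointedSection, p.jet r = θ := ⟨θ.rep, θ.jet_rep⟩
  exact (c.total_section p.sec p.mem hθ).1

theorem AdaptedChart.base_eq (c : π.AdaptedChart) {θ : π.Jet r}
    (hθ : θ ∈ (c.jetChart r).source) : θ.base = c.base.symm (c.jetChart r θ).1 :=
  (c.base.left_inv (c.base_mem hθ)).symm

theorem AdaptedChart.base_symm_jetChart (c : π.AdaptedChart) {z : JetModel V W r}
    (hz : z ∈ (c.jetChart r).target) :
    ((c.jetChart r).symm z).base = c.base.symm z.1 := by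
  rw [c.base_eq ((c.jetChart r).map_target hz), (c.jetChart r).right_inv hz]

theorem AdaptedChart.exists_mem_jetChart_source (θ : π.Jet r) :
    ∃ c : π.AdaptedChart, θ ∈ (c.jetChart r).source :=
  ⟨π.adaptedChartAt θ.value, π.mem_adaptedChartAt θ.value⟩

theorem AdaptedChart.mdifferentiableAt_base (c : π.AdaptedChart) {x : M}
    (hx : x ∈ c.base.source) : MDifferentiableAt 𝓘(ℝ, V) 𝓘(ℝ, V) c.base x :=
  (c.smooth_base.contMDiffAt (c.base.open_source.mem_nhds hx)).mdifferentiableAt (by simp)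

theorem AdaptedChart.mdifferentiableAt_base_symm (c : π.AdaptedChart) {y : V}
    (hy : y ∈ c.base.target) : MDifferentiableAt 𝓘(ℝ, V) 𝓘(ℝ, V) c.base.symm y :=
  (c.smooth_base_symm.contMDiffAt (c.base.open_target.mem_nhds hy)).mdifferentiableAt (by simp)

theorem AdaptedChart.mfderiv_base_comp_symm (c : π.AdaptedChart) {y : V}
    (hy : y ∈ c.base.target) :
    (mfderiv 𝓘(ℝ, V) 𝓘(ℝ, V) c.base (c.base.symm y) : V →L[ℝ] V).comp
      (mfderiv 𝓘(ℝ, V) 𝓘(ℝ, V) c.base.symm y : V →L[ℝ] V) = ContinuousLinearMap.id ℝ V := by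
  have h := mfderiv_comp y (c.mdifferentiableAt_base (c.base.map_target hy))
    (c.mdifferentiableAt_base_symm hy)
  have e : c.base ∘ c.base.symm =ᶠ[𝓝 y] id := by
    filter_upwards [c.base.open_target.mem_nhds hy] with w hw using c.base.right_inv hw
  rw [e.mfderiv_eq, mfderiv_id] at h
  exact h.symm

theorem AdaptedChart.contMDiffOn_jetChart_symm (c : π.AdaptedChart) (r : ℕ) :
    ContMDiffOn 𝓘(ℝ, JetModel V W r) 𝓘(ℝ, JetModel V W r) ∞ (c.jetChart r).symm
      (c.jetChart r).target :=
  contMDiffOn_symm_of_mem_maximalAtlas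
    (IsManifold.subset_maximalAtlas (mem_atlas_jet.2 ⟨c, rfl⟩))

theorem AdaptedChart.contMDiffOn_jetChart (c : π.AdaptedChart) (r : ℕ) :
    ContMDiffOn 𝓘(ℝ, JetModel V W r) 𝓘(ℝ, JetModel V W r) ∞ (c.jetChart r)
      (c.jetChart r).source :=
  contMDiffOn_of_mem_maximalAtlas
    (IsManifold.subset_maximalAtlas (mem_atlas_jet.2 ⟨c, rfl⟩))

theorem AdaptedChart.mdifferentiableAt_jetChart_symm (c : π.AdaptedChart) {z : JetModel V W r}
    (hz : z ∈ (c.jetChart r).target) :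
    MDifferentiableAt 𝓘(ℝ, JetModel V W r) 𝓘(ℝ, JetModel V W r) (c.jetChart r).symm z :=
  ((c.contMDiffOn_jetChart_symm r).contMDiffAt
    ((c.jetChart r).open_target.mem_nhds hz)).mdifferentiableAt (by simp)

theorem AdaptedChart.hasMFDerivAt_base_symm_fst (c : π.AdaptedChart) {z : JetModel V W r}
    (hz : z ∈ (c.jetChart r).target) :
    HasMFDerivAt 𝓘(ℝ, JetModel V W r) 𝓘(ℝ, V) (fun w : JetModel V W r => c.base.symm w.1) z
      ((mfderiv 𝓘(ℝ, V) 𝓘(ℝ, V) c.base.symm z.1 : V →L[ℝ] V).comp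
        (ContinuousLinearMap.fst ℝ V _)) :=
  HasMFDerivAt.comp (I' := 𝓘(ℝ, V)) (g := c.base.symm) (f := Prod.fst) z
    (c.mdifferentiableAt_base_symm (c.mem_target_base hz)).hasMFDerivAt
    (hasFDerivAt_fst.hasMFDerivAt)

/-- In an induced chart the projection to `M` is the first coordinate followed by the inverse of the
base chart. -/
theorem Jet.mdifferentiableAt_base (θ : π.Jet r) :
    MDifferentiableAt 𝓘(ℝ, JetModel V W r) 𝓘(ℝ, V) (Jet.base (π := π)) θ := by
  obtain ⟨c, hc⟩ := AdaptedChart.exists_mem_jetChart_source θ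
  have e : Jet.base =ᶠ[𝓝 θ] (fun w : JetModel V W r => c.base.symm w.1) ∘ c.jetChart r := by
    filter_upwards [(c.jetChart r).open_source.mem_nhds hc] with θ' h using c.base_eq h
  refine MDifferentiableAt.congr_of_eventuallyEq ?_ e
  exact MDifferentiableAt.comp (I' := 𝓘(ℝ, JetModel V W r)) θ
    (c.hasMFDerivAt_base_symm_fst ((c.jetChart r).map_source hc)).mdifferentiableAt
    (((c.contMDiffOn_jetChart r).contMDiffAt
      ((c.jetChart r).open_source.mem_nhds hc)).mdifferentiableAt (by simp))

/-- The coordinate expression of the differential of `Jʳπ → M`. -/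
theorem AdaptedChart.mfderiv_jetBase_comp_symm (c : π.AdaptedChart) {z : JetModel V W r}
    (hz : z ∈ (c.jetChart r).target) :
    (mfderiv 𝓘(ℝ, JetModel V W r) 𝓘(ℝ, V) (Jet.base (π := π)) ((c.jetChart r).symm z) :
        JetModel V W r →L[ℝ] V).comp
      (mfderiv 𝓘(ℝ, JetModel V W r) 𝓘(ℝ, JetModel V W r) (c.jetChart r).symm z :
        JetModel V W r →L[ℝ] JetModel V W r) =
    (mfderiv 𝓘(ℝ, V) 𝓘(ℝ, V) c.base.symm z.1 : V →L[ℝ] V).comp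
      (ContinuousLinearMap.fst ℝ V _) := by
  have h := mfderiv_comp z (Jet.mdifferentiableAt_base ((c.jetChart r).symm z))
    (c.mdifferentiableAt_jetChart_symm hz)
  have e : Jet.base ∘ (c.jetChart r).symm =ᶠ[𝓝 z] fun w => c.base.symm w.1 := by
    filter_upwards [(c.jetChart r).open_target.mem_nhds hz] with w hw
      using c.base_symm_jetChart hw
  rw [e.mfderiv_eq, (c.hasMFDerivAt_base_symm_fst hz).mfderiv] at h
  exact h.symm

/-! ### Differentials of prolongations and the contact map. -/

/-- The derivative of `Dʲu` is `D^{j+1}u` with its first argument split off. This identifies the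
algebraic model `contact` with an actual differential. -/
theorem AdaptedChart.fderiv_prolongRep (c : π.AdaptedChart) (p : π.PointedSection)
    (hp : p.value ∈ c.total.source) :
    fderiv ℝ (c.prolongRep p.sec.toFun r) (c.base p.pt) =
      (c.coord (r + 1) (p.jet (r + 1))).contact := by
  rw [(c.hasFDerivAt_prolongRep (r := r) p hp).fderiv]
  ext1 v
  rw [JetModel.contact_apply]
  refine Prod.ext rfl (funext fun j : Fin (r + 1) => ?_)
  have h : SymForm.incl ((j : ℕ) + 1) ((c.coord (r + 1) (p.jet (r + 1))).2 j.succ) =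
    iteratedFDeriv ℝ (j + 1) (c.localRep p.sec.toFun) (c.base p.pt) :=
    c.incl_coord p hp j.succ
  change symmetrize (j : ℕ) _ = symmetrize (j : ℕ) _
  rw [h]
  rfl

/-- Chain rule for `j_r s`, read locally through the base chart, `prolongRep` and the inverse jet
chart. The foot point uses the `r`-jet, while the middle factor needs the `(r+1)`-jet. -/
theorem AdaptedChart.hasMFDerivAt_prolong (c : π.AdaptedChart) (p : π.PointedSection)
    (hp : p.value ∈ c.total.source) :
    HasMFDerivAt 𝓘(ℝ, V) 𝓘(ℝ, JetModel V W r) (p.sec.prolong r) p.pt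
      ((mfderiv 𝓘(ℝ, JetModel V W r) 𝓘(ℝ, JetModel V W r) (c.jetChart r).symm
          (c.coord r (p.jet r)) : JetModel V W r →L[ℝ] JetModel V W r).comp
        ((c.coord (r + 1) (p.jet (r + 1))).contact.comp
          (mfderiv 𝓘(ℝ, V) 𝓘(ℝ, V) c.base p.pt : V →L[ℝ] V))) := by
  refine HasMFDerivAt.congr_of_eventuallyEq ?_ (c.prolong_eventuallyEq (r := r) p hp)
  have d1 := (c.mdifferentiableAt_base (c.total_section p.sec p.mem hp).1).hasMFDerivAt
  have d2 : HasMFDerivAt 𝓘(ℝ, V) 𝓘(ℝ, JetModel V W r) (c.prolongRep p.sec.toFun r)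
      (c.base p.pt) (c.coord (r + 1) (p.jet (r + 1))).contact := by
    rw [← c.fderiv_prolongRep p hp]
    exact (c.hasFDerivAt_prolongRep (r := r) p hp).differentiableAt.hasFDerivAt.hasMFDerivAt
  have h : c.coord r (p.jet r) = c.prolongRep p.sec.toFun r (c.base p.pt) := c.coord_jet p hp
  have d3 := (c.mdifferentiableAt_jetChart_symm (r := r) (z := c.coord r (p.jet r))
    ((c.jetChart r).map_source (x := p.jet r) hp)).hasMFDerivAt
  rw [h] at d3 ⊢
  exact d3.comp p.pt (d2.comp p.pt d1)

theorem PointedSection.mdifferentiableAt_prolong (p : π.PointedSection) (r : ℕ) :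
    MDifferentiableAt 𝓘(ℝ, V) 𝓘(ℝ, JetModel V W r) (p.sec.prolong r) p.pt :=
  ((π.adaptedChartAt p.value).hasMFDerivAt_prolong p
    (π.mem_adaptedChartAt p.value)).mdifferentiableAt

/-- The contact map at `j_{r+1} s (x)` is the differential of `j_r s` at `x`. -/
theorem PointedSection.contactMap_jet (p : π.PointedSection) :
    (contactMap (p.jet (r + 1)) : V →L[ℝ] JetModel V W r) =
      mfderiv 𝓘(ℝ, V) 𝓘(ℝ, JetModel V W r) (p.sec.prolong r) p.pt :=
  -- The chosen representative of the jet and `p` have the same `(r+1)`-jet, which determines the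
  -- differential of the prolongation of order `r`.
  mfderiv_prolong_eq (p.jet (r + 1)).jet_rep

/-- Prolongations are sections of `Jʳπ → M`. -/
theorem PointedSection.mfderiv_base_comp_prolong (p : π.PointedSection) :
    (mfderiv 𝓘(ℝ, JetModel V W r) 𝓘(ℝ, V) (Jet.base (π := π)) (p.jet r) :
        JetModel V W r →L[ℝ] V).comp
      (mfderiv 𝓘(ℝ, V) 𝓘(ℝ, JetModel V W r) (p.sec.prolong r) p.pt :
        V →L[ℝ] JetModel V W r) = ContinuousLinearMap.id ℝ V := by
  have h := mfderiv_comp p.pt (Jet.mdifferentiableAt_base (p.sec.prolong r p.pt))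
    (p.mdifferentiableAt_prolong r)
  have e : Jet.base ∘ p.sec.prolong r =ᶠ[𝓝 p.pt] id := by
    filter_upwards [p.sec.isOpen_dom.mem_nhds p.mem] with x hx
    rw [Function.comp_apply, p.sec.prolong_of_mem hx]
    rfl
  rw [e.mfderiv_eq, mfderiv_id, p.sec.prolong_of_mem p.mem] at h
  exact h.symm

/-- The coordinate expression of the contact map. -/
theorem AdaptedChart.contactMap_eq (c : π.AdaptedChart) {θ : π.Jet (r + 1)}
    (hθ : θ ∈ (c.jetChart (r + 1)).source) :
    (contactMap θ : V →L[ℝ] JetModel V W r) =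
      (mfderiv 𝓘(ℝ, JetModel V W r) 𝓘(ℝ, JetModel V W r) (c.jetChart r).symm
          (c.jetChart (r + 1) θ).truncate : JetModel V W r →L[ℝ] JetModel V W r).comp
        ((c.jetChart (r + 1) θ).contact.comp
          (mfderiv 𝓘(ℝ, V) 𝓘(ℝ, V) c.base θ.base : V →L[ℝ] V)) := by
  obtain ⟨p, rfl⟩ : ∃ p : π.PointedSection, p.jet (r + 1) = θ := ⟨θ.rep, θ.jet_rep⟩
  have h : c.coord r (p.jet r) = (c.jetChart (r + 1) (p.jet (r + 1))).truncate :=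
    c.coord_proj (p.jet (r + 1)) hθ
  rw [p.contactMap_jet, (c.hasMFDerivAt_prolong (r := r) p hθ).mfderiv, h]
  rfl

/-! ### The horizontalization in coordinates. -/

/-- The chase is `C A B = T D b S P = T D P`. It is applied with `C` the contact map, `A` the
differential of the projection to `M`, `B` and `T` those of inverse jet charts, `b` and `S` those of
the base chart and its inverse, and `D` the model contact map. -/
theorem congr_of_comp_eq {X₁ X₂ X₃ X₄ X₅ X₆ : Type*}
    [NormedAddCommGroup X₁] [NormedSpace ℝ X₁] [NormedAddCommGroup X₂] [NormedSpace ℝ X₂]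
    [NormedAddCommGroup X₃] [NormedSpace ℝ X₃] [NormedAddCommGroup X₄] [NormedSpace ℝ X₄]
    [NormedAddCommGroup X₅] [NormedSpace ℝ X₅] [NormedAddCommGroup X₆] [NormedSpace ℝ X₆]
    {C : X₃ →L[ℝ] X₆} {A : X₂ →L[ℝ] X₃} {B : X₁ →L[ℝ] X₂} {S : X₄ →L[ℝ] X₃} {P : X₁ →L[ℝ] X₄}
    {T : X₅ →L[ℝ] X₆} {D : X₄ →L[ℝ] X₅} {b : X₃ →L[ℝ] X₄} (h₁ : C = T.comp (D.comp b))
    (h₂ : A.comp B = S.comp P) (h₃ : b.comp S = ContinuousLinearMap.id ℝ X₄) (w : X₁) :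
    C (A (B w)) = T (D (P w)) := by
  have h₂' : A (B w) = S (P w) := DFunLike.congr_fun h₂ w
  have h₃' : b (S (P w)) = P w := DFunLike.congr_fun h₃ (P w)
  rw [h₁, h₂', ContinuousLinearMap.comp_apply, ContinuousLinearMap.comp_apply, h₃']

/-- The coordinate expression of the horizontalization. -/
theorem AdaptedChart.chartRep_horizontalization (c : π.AdaptedChart)
    (β : FormField (JetModel V W r) (π.Jet r) k) {z : JetModel V W (r + 1)}
    (hz : z ∈ (c.jetChart (r + 1)).target) :
    chartRep (c.jetChart (r + 1)) (horizontalization β) z =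
      (chartRep (c.jetChart r) β z.truncate).compContinuousLinearMap
        (z.contact.comp (ContinuousLinearMap.fst ℝ V _)) := by
  have h1 := c.contactMap_eq ((c.jetChart (r + 1)).map_target hz)
  rw [(c.jetChart (r + 1)).right_inv hz, c.base_symm_jetChart hz] at h1
  have h2 := c.mfderiv_jetBase_comp_symm hz
  have h3 := c.mfderiv_base_comp_symm (y := z.1) (c.mem_target_base hz)
  have h4 := c.jetChart_symm_truncate hz
  ext v
  have key : ∀ w : JetModel V W (r + 1),
      (contactMap ((c.jetChart (r + 1)).symm z) : V →L[ℝ] JetModel V W r)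
        ((mfderiv 𝓘(ℝ, JetModel V W (r + 1)) 𝓘(ℝ, V) (Jet.base (π := π))
            ((c.jetChart (r + 1)).symm z) : JetModel V W (r + 1) →L[ℝ] V)
          ((mfderiv 𝓘(ℝ, JetModel V W (r + 1)) 𝓘(ℝ, JetModel V W (r + 1))
            (c.jetChart (r + 1)).symm z : JetModel V W (r + 1) →L[ℝ] JetModel V W (r + 1)) w)) =
      (mfderiv 𝓘(ℝ, JetModel V W r) 𝓘(ℝ, JetModel V W r) (c.jetChart r).symm
          z.truncate : JetModel V W r →L[ℝ] JetModel V W r) (z.contact w.1) := by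
    exact congr_of_comp_eq (X₁ := JetModel V W (r + 1)) (X₂ := JetModel V W (r + 1))
      (X₃ := V) (X₄ := V) (X₅ := JetModel V W r) (X₆ := JetModel V W r) h1 h2 h3
  -- The two sides evaluate `β` at foot points that are equal only by `h4`; tangent spaces at all
  -- points are the same model space, so the values can be compared.
  have hβ : ∀ (θ θ' : π.Jet r) (_ : θ = θ') (u : Fin k → JetModel V W r),
      (β θ : JetModel V W r [⋀^Fin k]→L[ℝ] ℝ) u =
        (β θ' : JetModel V W r [⋀^Fin k]→L[ℝ] ℝ) u := by
    rintro θ _ rfl u; rfl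
  refine (hβ _ _ h4.symm _).trans ?_
  exact congrArg (β ((c.jetChart r).symm z.truncate) : JetModel V W r [⋀^Fin k]→L[ℝ] ℝ)
    (funext fun i => key (v i))

/-! ### Smoothness, horizontality and fibre degree. -/

theorem mem_forms_iff {η : FormField (JetModel V W r) (π.Jet r) k} :
    η ∈ π.forms r k ↔ ∀ c : π.AdaptedChart,
      ContDiffOn ℝ ∞ (chartRep (c.jetChart r) η) (c.jetChart r).target := by
  constructor
  · exact fun h c => h _ (mem_atlas_jet.2 ⟨c, rfl⟩)
  · intro h e he
    obtain ⟨c, rfl⟩ := mem_atlas_jet.1 he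
    exact h c

theorem zero_mem_forms : (0 : FormField (JetModel V W r) (π.Jet r) k) ∈ π.forms r k :=
  fun _ _ => contDiffOn_const (c := (0 : JetModel V W r [⋀^Fin k]→L[ℝ] ℝ))

theorem add_mem_forms {η η' : FormField (JetModel V W r) (π.Jet r) k} (h : η ∈ π.forms r k)
    (h' : η' ∈ π.forms r k) : η + η' ∈ π.forms r k :=
  fun e he => (h e he).add (h' e he)

theorem smul_mem_forms {f : π.Jet r → ℝ}
    (hf : ContMDiff 𝓘(ℝ, JetModel V W r) 𝓘(ℝ, ℝ) ∞ f)
    {η : FormField (JetModel V W r) (π.Jet r) k} (h : η ∈ π.forms r k) :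
    (fun θ => f θ • η θ) ∈ π.forms r k := by
  rw [mem_forms_iff] at h ⊢
  intro c
  have hfc : ContDiffOn ℝ ∞ (f ∘ (c.jetChart r).symm) (c.jetChart r).target :=
    contMDiffOn_iff_contDiffOn.1 (hf.comp_contMDiffOn (c.contMDiffOn_jetChart_symm r))
  exact hfc.smul (h c)

/-- In coordinates this is a smooth pull-back operation applied to the expression of `β` after
truncation and to the smoothly varying model contact map. -/
theorem horizontalization_mem_forms {β : FormField (JetModel V W r) (π.Jet r) k}
    (hβ : β ∈ π.forms r k) : horizontalization β ∈ π.forms (r + 1) k := by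
  rw [mem_forms_iff] at hβ ⊢
  intro c
  refine ContDiffOn.congr ?_ fun z hz => c.chartRep_horizontalization β hz
  refine contDiff_compContinuousLinearMap.comp_contDiffOn (ContDiffOn.prodMk
    ((hβ c).comp JetModel.contDiff_truncate.contDiffOn fun z hz => hz) ?_)
  exact (JetModel.contDiff_contact.clm_comp contDiff_const).contDiffOn

theorem horizontalization_mem_horizontalForms {β : FormField (JetModel V W r) (π.Jet r) k}
    (hβ : β ∈ π.forms r k) : horizontalization β ∈ π.horizontalForms (r + 1) k := by
  refine ⟨horizontalization_mem_forms hβ, fun θ v i hi => ?_⟩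
  refine ContinuousAlternatingMap.map_coord_zero (β θ.proj) i ?_
  change contactMap θ (mfderiv 𝓘(ℝ, JetModel V W (r + 1)) 𝓘(ℝ, V) Jet.base θ (v i)) = 0
  rw [hi, map_zero]

/-- Along a fibre the form `chartRep β z.truncate` is fixed and the linear map along which it is
pulled back moves affinely, so the `k`-linear diagonal `m` has degree at most `k` in `q`. -/
theorem horizontalization_mem_polynomialHorizontalForms
    {β : FormField (JetModel V W r) (π.Jet r) k} (hβ : β ∈ π.forms r k) :
    horizontalization β ∈ π.polynomialHorizontalForms r k := by
  refine ⟨horizontalization_mem_horizontalForms hβ, fun c z hz => ?_⟩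
  obtain ⟨m, hm⟩ := exists_multilinear_compContinuousLinearMap
    (F := JetModel V W (r + 1)) (chartRep (c.jetChart r) β z.truncate)
  -- `Φ A = A ∘ fst`; being linear, it keeps the dependence on `q` affine.
  let Φ : (V →L[ℝ] JetModel V W r) →L[ℝ] (JetModel V W (r + 1) →L[ℝ] JetModel V W r) :=
    (ContinuousLinearMap.compL ℝ (JetModel V W (r + 1)) V (JetModel V W r)).flip
      (ContinuousLinearMap.fst ℝ V _)
  have h : ∀ q : SymForm V W (Fin.last (r + 1)),
      chartRep (c.jetChart (r + 1)) (horizontalization β)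
          (z.1, Function.update z.2 (Fin.last (r + 1)) q) =
        m fun _ => Φ (JetModel.contact (z.1, Function.update z.2 (Fin.last (r + 1)) 0)) +
          (Φ.comp ((JetModel.contactLinear V W r).comp (ContinuousLinearMap.single ℝ
            (fun i : Fin (r + 2) => SymForm V W i) (Fin.last (r + 1))))) q := by
    intro q
    -- The whole fibre stays in the chart: the domain constrains only `(x, u)`, and the changed slot
    -- has order `r + 1 > 0`.
    have hq : (z.1, Function.update z.2 (Fin.last (r + 1)) q) ∈
        (c.jetChart (r + 1)).target := by
      change JetModel.value _ ∈ c.total.target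
      rw [← JetModel.value_truncate, JetModel.truncate_update, JetModel.value_truncate]
      exact hz
    rw [c.chartRep_horizontalization β hq, JetModel.truncate_update, hm, z.contact_update q]
    rfl
  simp only [h]
  exact isPolynomialOfDegreeLE_multilinear_affine m _ _

/-! ### Pull-backs along prolongations. -/

/-- At `θ = j_{r+1}s(x)` one has `D_θ ∘ Tπ^{r+1} ∘ T_x(j_{r+1}s) = D_θ = T_x(j_r s)`. -/
theorem LocalSection.pullbackForm_horizontalization (s : π.LocalSection)
    (β : FormField (JetModel V W r) (π.Jet r) k) {x : M} (hx : x ∈ s.dom) :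
    s.pullbackForm (r + 1) (horizontalization β) x = s.pullbackForm r β x := by
  let p : π.PointedSection := ⟨s, x, hx⟩
  have h1 := p.contactMap_jet (r := r)
  have h2 := p.mfderiv_base_comp_prolong (r := r + 1)
  have e1 : s.prolong (r + 1) x = p.jet (r + 1) := s.prolong_of_mem hx
  have e0 : s.prolong r x = p.jet r := s.prolong_of_mem hx
  ext v
  change (β (s.prolong (r + 1) x).proj : JetModel V W r [⋀^Fin k]→L[ℝ] ℝ) (fun i =>
    (contactMap (s.prolong (r + 1) x) : V →L[ℝ] JetModel V W r)
      ((mfderiv 𝓘(ℝ, JetModel V W (r + 1)) 𝓘(ℝ, V) (Jet.base (π := π)) (s.prolong (r + 1) x) :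
        JetModel V W (r + 1) →L[ℝ] V) ((mfderiv 𝓘(ℝ, V) 𝓘(ℝ, JetModel V W (r + 1))
          (s.prolong (r + 1)) x : V →L[ℝ] JetModel V W (r + 1)) (v i)))) =
    (β (s.prolong r x) : JetModel V W r [⋀^Fin k]→L[ℝ] ℝ) fun i =>
      (mfderiv 𝓘(ℝ, V) 𝓘(ℝ, JetModel V W r) (s.prolong r) x : V →L[ℝ] JetModel V W r) (v i)
  rw [e1, e0, h1]
  refine congrArg (β (p.jet r) : JetModel V W r [⋀^Fin k]→L[ℝ] ℝ) (funext fun i => ?_)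
  exact congrArg (mfderiv 𝓘(ℝ, V) 𝓘(ℝ, JetModel V W r) (s.prolong r) x :
    V →L[ℝ] JetModel V W r) (DFunLike.congr_fun h2 (v i))

/-- Horizontal forms on `Jʳπ` are determined by their pull-backs along prolongations. -/
theorem eq_of_pullbackForm_eq {α α' : FormField (JetModel V W r) (π.Jet r) k}
    (hα : α ∈ π.horizontalForms r k) (hα' : α' ∈ π.horizontalForms r k)
    (h : ∀ s : π.LocalSection, ∀ x ∈ s.dom, s.pullbackForm r α x = s.pullbackForm r α' x) :
    α = α' := by
  funext θ
  obtain ⟨p, rfl⟩ : ∃ p : π.PointedSection, p.jet r = θ := ⟨θ.rep, θ.jet_rep⟩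
  have e : p.sec.prolong r p.pt = p.jet r := p.sec.prolong_of_mem p.mem
  have h2 := p.mfderiv_base_comp_prolong (r := r)
  let P : JetModel V W r →L[ℝ] V :=
    mfderiv 𝓘(ℝ, JetModel V W r) 𝓘(ℝ, V) (Jet.base (π := π)) (p.jet r)
  let S : V →L[ℝ] JetModel V W r :=
    mfderiv 𝓘(ℝ, V) 𝓘(ℝ, JetModel V W r) (p.sec.prolong r) p.pt
  have hPS : ∀ v, P (S v) = v := fun v => DFunLike.congr_fun h2 v
  have key : ∀ η ∈ π.horizontalForms r k, ∀ v : Fin k → JetModel V W r,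
      (η (p.jet r) : JetModel V W r [⋀^Fin k]→L[ℝ] ℝ) v =
        (p.sec.pullbackForm r η p.pt : V [⋀^Fin k]→L[ℝ] ℝ) fun i => P (v i) := by
    intro η hη v
    change _ = (η (p.sec.prolong r p.pt) : JetModel V W r [⋀^Fin k]→L[ℝ] ℝ) fun i => S (P (v i))
    rw [e]
    -- Since `P S = id`, the vectors `v i` and `S (P (v i))` have the same projection to `M`, and a
    -- horizontal form does not distinguish them.
    exact multilinear_eq_of_horizontal
      (η (p.jet r) : JetModel V W r [⋀^Fin k]→L[ℝ] ℝ).toMultilinearMap P.toLinearMap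
      (fun w i hw => hη.2 (p.jet r) w i hw) fun i => (hPS (P (v i))).symm
  refine ContinuousAlternatingMap.ext fun v => ?_
  exact (key α hα v).trans ((DFunLike.congr_fun (h p.sec p.pt p.mem) _).trans (key α' hα' v).symm)

end Geometry

end FibredManifold
end FibredJet

end

/-! ### The three assertions. -/

theorem mainTheorem9 {V W EE M E : Type*}
    [NormedAddCommGroup V] [NormedSpace ℝ V] [FiniteDimensional ℝ V]
    [NormedAddCommGroup W] [NormedSpace ℝ W] [FiniteDimensional ℝ W]
    [NormedAddCommGroup EE] [NormedSpace ℝ EE] [FiniteDimensional ℝ EE]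
    [TopologicalSpace M] [ChartedSpace V M] [IsManifold 𝓘(ℝ, V) ∞ M]
    [TopologicalSpace E] [ChartedSpace EE E] [IsManifold 𝓘(ℝ, EE) ∞ E]
    (π : FibredJet.FibredManifold V W EE M E) (r k : ℕ) (hk : 0 < k)
    (hkn : k ≤ Module.finrank ℝ V) :
    -- the inclusion of the image of `h` in the polynomial horizontal forms
    π.horizontalImage r k ⊆ π.polynomialHorizontalForms r k ∧
    -- the image of `h` is a module over the smooth functions on the jet space of order `r`
    (0 ∈ π.horizontalImage r k ∧
      (∀ α ∈ π.horizontalImage r k, ∀ α' ∈ π.horizontalImage r k,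
        α + α' ∈ π.horizontalImage r k) ∧
      ∀ f : π.Jet r → ℝ, ContMDiff 𝓘(ℝ, FibredJet.JetModel V W r) 𝓘(ℝ, ℝ) ∞ f →
        ∀ α ∈ π.horizontalImage r k,
          (fun θ => f θ.proj • α θ) ∈ π.horizontalImage r k) ∧
    -- the characterization of the image of `h`
    (∀ α ∈ π.polynomialHorizontalForms r k,
      α ∈ π.horizontalImage r k ↔
        ∃ β ∈ π.forms r k, ∀ s : π.LocalSection, ∀ x ∈ s.dom,
          s.pullbackForm r β x = s.pullbackForm (r + 1) α x) := by
  open FibredJet FibredJet.FibredManifold in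
  refine ⟨?_, ⟨⟨0, zero_mem_forms, rfl⟩, ?_, ?_⟩, fun α hα => ⟨?_, ?_⟩⟩
  · rintro _ ⟨β, hβ, rfl⟩
    exact horizontalization_mem_polynomialHorizontalForms hβ
  · rintro _ ⟨β, hβ, rfl⟩ _ ⟨β', hβ', rfl⟩
    exact ⟨β + β', add_mem_forms hβ hβ', rfl⟩
  · rintro f hf _ ⟨β, hβ, rfl⟩
    -- `h` evaluates its argument at `θ.proj`, so a factor `f` on `Jʳπ` comes out as its pull-back
    -- to `J^{r+1}π`.
    exact ⟨fun θ => f θ • β θ, smul_mem_forms hf hβ, rfl⟩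
  · rintro ⟨β, hβ, rfl⟩
    exact ⟨β, hβ, fun s x hx => (s.pullbackForm_horizontalization β hx).symm⟩
  · rintro ⟨β, hβ, h⟩
    -- The given `β` is itself the preimage: `h β` and `α` are horizontal with the same pull-backs
    -- along all prolongations.
    exact ⟨β, hβ, eq_of_pullbackForm_eq (horizontalization_mem_horizontalForms hβ) hα.1
      fun s x hx => (s.pullbackForm_horizontalization β hx).trans (h s x hx)⟩
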